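/- Conventions. A surface is a connected Hausdorff space that is locally homeomorphic to $\mathbb{R}^2$. The closed long ray $\mathbb{L}_{\ge 0}$ is $\omega_1\times[0,1)$ with the lexicographic order topology, and the (open) long ray is $\mathbb{L}_+=\mathbb{L}_{\ge 0}\setminus\{0\}$, where $0$ is the least element. A (one-dimensional) foliation of a surface $M$ is a maximal atlas $\{(U_i,\varphi_i)\}$ of $M$, with charts $\varphi_i:U_i\to\mathbb{R}\times\mathbb{R}$ that are homeomorphisms onto open sets, such that each coordinate change $\varphi_j\varphi_i^{-1}:\varphi_i(U_i\cap U_j)\to\varphi_j(U_i\cap U_j)$ has the form $(x,y)\mapsto(g_{ij}(x,y),h_{ij}(y))$, where $h_{ij}$ is an embedding into $\mathbb{R}$ of the projection of $\varphi_i(U_i\cap U_j)$ to the second axis. The connected components of the sets $\varphi_i^{-1}(\mathbb{R}\times\{y\})$ are called plaques; they form a basis of the leaf topology on $M$. The leaves are the path components of $M$ in the leaf topology, and each leaf is given the topology induced by the leaf topology. Theorem. There is a separable surface $M=O\sqcup L$ (disjoint union of sets), where the subspace $O$ is open in $M$ and homeomorphic to $\mathbb{R}^2\setminus\{(0,0)\}$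 and the subspace $L$ is homeomorphic to the closed long ray $\mathbb{L}_{\ge 0}$, and there is a foliation of $M$ with exactly one exceptional leaf $\Lambda$ such that $\Lambda$ is homeomorphic to the open long ray $\mathbb{L}_+$ and every other leaf is homeomorphic to $\mathbb{R}$. Moreover, the neighbours of the long leaf are not long: every neighbourhood in $M$ of every point of $\Lambda$ meets a leaf, different from $\Lambda$, that is homeomorphic to $\mathbb{R}$. -/

import Mathlib

open Set Topology

/-- A *surface*: a connected Hausdorff space locally homeomorphic to the plane. -/
structure IsSurface (M : Type*) [TopologicalSpace M] : Prop where
  hausdorff : T2Space M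
  connected : ConnectedSpace M
  locally_plane : ∀ x : M, ∃ φ : OpenPartialHomeomorph M (ℝ × ℝ), x ∈ φ.source

/-- The closed long ray `ω₁ × [0, 1)`, with the lexicographic order. -/
def ClosedLongRay : Type :=
  (Ordinal.omega 1 : Ordinal.{0}).ToType ×ₗ Set.Ico (0 : ℝ) 1

noncomputable instance : LinearOrder ClosedLongRay :=
  inferInstanceAs (LinearOrder ((Ordinal.omega 1 : Ordinal.{0}).ToType ×ₗ Set.Ico (0 : ℝ) 1))

/-- The closed long ray carries the order topology. -/
noncomputable instance : TopologicalSpace ClosedLongRay := Preorder.topology ClosedLongRay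

/-- The open long ray: the closed long ray without its least element `(0, 0)`,
with the subspace topology. -/
abbrev OpenLongRay : Type := {x : ClosedLongRay // ¬ IsMin x}

/-- The coordinate change from the chart `φ` to the chart `ψ` has the form
`(x, y) ↦ (g (x, y), h y)` on its whole domain `φ (U ∩ V)`, where `h` is a topological embedding
of the projection of this domain to the second axis into `ℝ`. -/
def FoliatedChange {M : Type*} [TopologicalSpace M]
    (φ ψ : OpenPartialHomeomorph M (ℝ × ℝ)) : Prop :=
  ∃ (g : ℝ × ℝ → ℝ) (h : ℝ → ℝ),
    (∀ p ∈ (φ.symm.trans ψ).source, (φ.symm.trans ψ) p = (g p, h p.2)) ∧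
    IsEmbedding ((Prod.snd '' (φ.symm.trans ψ).source).domRestrict h)

/-- An atlas of `M`, with charts in `ℝ × ℝ`, all of whose coordinate changes preserve the
partition of the plane into the lines `y = const`. -/
structure IsFoliatedAtlas {M : Type*} [TopologicalSpace M]
    (A : Set (OpenPartialHomeomorph M (ℝ × ℝ))) : Prop where
  cover : ∀ x : M, ∃ φ ∈ A, x ∈ φ.source
  change : ∀ φ ∈ A, ∀ ψ ∈ A, FoliatedChange φ ψ

/-- A one-dimensional (topological) foliation of a surface: a maximal foliated atlas. -/
structure Foliation (M : Type*) [TopologicalSpace M] where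
  atlas : Set (OpenPartialHomeomorph M (ℝ × ℝ))
  maximal : Maximal IsFoliatedAtlas atlas

namespace Foliation

variable {M : Type*} [TopologicalSpace M]

/-- The plaques: the connected components of the sets `φ⁻¹(ℝ × {y})`, for `φ` a foliated chart;
here the component of the point `x`, with `y` the second coordinate of `φ x`. -/
def plaques (F : Foliation M) : Set (Set M) :=
  {P | ∃ φ ∈ F.atlas, ∃ x ∈ φ.source,
    P = connectedComponentIn (φ.source ∩ {z | (φ z).2 = (φ x).2}) x}

/-- The leaf topology on `M`, generated by the plaques. -/
@[reducible] def leafTopology (F : Foliation M) : TopologicalSpace M :=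
  TopologicalSpace.generateFrom F.plaques

/-- The leaves are the path components of `M` for the leaf topology. -/
def IsLeaf (F : Foliation M) (l : Set M) : Prop :=
  ∃ x : M, l = @pathComponent M F.leafTopology x

/-- The set `l`, with the topology that the leaf topology induces on it, is homeomorphic
to `X`. -/
def LeafHomeomorphic (F : Foliation M) (l : Set M) (X : Type*) [tX : TopologicalSpace X] : Prop :=
  Nonempty (@Homeomorph l X (TopologicalSpace.induced Subtype.val F.leafTopology) tX)

end Foliation

/-! Replace the axis `y = 0` of the plane by the open long ray. By recursion on `ω₁`, choose
continuous functions `g_β`, each eventually exceeding every earlier one by at least 1; this is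
possible since initial segments of `ω₁` are countable (`exists_continuous_eventually_add_one_le`).
The topology is arranged so that, for `0 < s < 1`, the curve `x = g_β (1/|y|) + s` tends to the
point `(β, s)` of the ray as `y → 0` (`LongPlane.continuousAt_curve`). For this, truncations of `x -
g_β (1/|y|)` to `[0, 1]` extend by the corresponding `ramp β` on the ray.

Given `α ≠ ⊥`, put positive weights of total 1 on the countably many indices below `α`. The weighted
sum of the ramps, mixed with a term `drift` that is strictly increasing in `x` off the ray, is the
first coordinate of a chart whose second coordinate is the height `y`. Its domain is a plane
containing everything off the ray and the part of the ray below index `α`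
(`IsWeight.exists_homeomorph`). Any two points share such a domain, hence the Hausdorff property.

For `α = succ ⊥` the domain omits exactly the tail of the ray from index 1 on, a closed long ray
because `1 + ω₁ = ω₁`. The domain is dense, so separability follows; removing a point at height 1
makes it a punctured plane.

The charts all preserve the height, so they define a foliation whose leaf topology is the surface
topology refined by the levels of the height (`leafTopology_eq_levelTopology`). Level 0 is the long
leaf, level 1 splits into two half-lines, and each other level is a line. Points of nonzero height
accumulate everywhere on the long leaf. -/

open Filter

/-! ### Foliations by the level sets of a function -/

section FoliationByFunction

variable {M : Type*} [TopologicalSpace M]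

/-- The charts of `M` whose second coordinate is the function `y`. -/
def levelAtlas (y : M → ℝ) : Set (OpenPartialHomeomorph M (ℝ × ℝ)) :=
  {φ | ∀ z ∈ φ.source, (φ z).2 = y z}

theorem isFoliatedAtlas_levelAtlas {y : M → ℝ} (hy : ∀ x, ∃ φ ∈ levelAtlas y, x ∈ φ.source) :
    IsFoliatedAtlas (levelAtlas y) := by
  refine ⟨hy, fun φ hφ ψ hψ => ⟨fun p => (ψ (φ.symm p)).1, id, fun p hp => ?_, ?_⟩⟩
  · simp only [OpenPartialHomeomorph.trans_source, OpenPartialHomeomorph.symm_source, mem_inter_iff,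
      mem_preimage] at hp
    have h1 := hψ _ hp.2
    have h2 := hφ _ (φ.map_target hp.1)
    rw [φ.right_inv hp.1] at h2
    ext
    · simp
    · simp [h1, h2]
  · exact IsEmbedding.subtypeVal

/-- Zorn's lemma: any two charts in the union of a chain already lie in one member of the chain. -/
theorem IsFoliatedAtlas.exists_foliation {A : Set (OpenPartialHomeomorph M (ℝ × ℝ))}
    (hA : IsFoliatedAtlas A) : ∃ F : Foliation M, A ⊆ F.atlas := by
  obtain ⟨m, hm, hmax⟩ := zorn_subset_nonempty {A | IsFoliatedAtlas A} (fun c hc hch hne => by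
    refine ⟨⋃₀ c, ⟨fun x => ?_, fun φ hφ ψ hψ => ?_⟩, fun s hs => subset_sUnion_of_mem hs⟩
    · obtain ⟨B, hB⟩ := hne
      obtain ⟨φ, hφ, hx⟩ := (hc hB).cover x
      exact ⟨φ, ⟨B, hB, hφ⟩, hx⟩
    · obtain ⟨B, hB, hφ⟩ := hφ
      obtain ⟨B', hB', hψ⟩ := hψ
      rcases hch.total hB hB' with h | h
      · exact (hc hB').change φ (h hφ) ψ hψ
      · exact (hc hB).change φ hφ ψ (h hψ)) A hA
  exact ⟨⟨m, hmax⟩, hm⟩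

/-- The topology of `M` refined by the level sets of `y`. -/
@[reducible] def levelTopology (y : M → ℝ) : TopologicalSpace M :=
  ‹TopologicalSpace M› ⊓ TopologicalSpace.induced y ⊥

theorem isOpen_levelTopology_inter {y : M → ℝ} {V : Set M} (hV : IsOpen V) (c : ℝ) :
    IsOpen[levelTopology y] (V ∩ y ⁻¹' {c}) := by
  have h1 : IsOpen[levelTopology y] V := hV.mono inf_le_left
  have h2 : IsOpen[levelTopology y] (y ⁻¹' {c}) := by
    refine IsOpen.mono (t₂ := TopologicalSpace.induced y ⊥) ?_ inf_le_right
    exact (isOpen_induced_iff (t := ⊥)).2 ⟨{c}, trivial, rfl⟩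
  exact @IsOpen.inter _ (levelTopology y) _ _ h1 h2

/-- The maximal atlas may contain charts unrelated to `y`. One inclusion uses only small
restrictions of the charts in `levelAtlas y`; the other shows that plaques of arbitrary charts are
still open in the level topology. -/
theorem leafTopology_eq_levelTopology {y : M → ℝ}
    (hy : ∀ x, ∃ φ ∈ levelAtlas y, x ∈ φ.source) (F : Foliation M) (hF : levelAtlas y ⊆ F.atlas) :
    F.leafTopology = levelTopology y := by
  have key : ∀ (V : Set M), IsOpen V → ∀ z ∈ V, ∃ P ∈ F.plaques, z ∈ P ∧ P ⊆ V ∩ y ⁻¹' {y z} := by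
    intro V hV z hz
    obtain ⟨φ, hφ, hzφ⟩ := hy z
    have hm : φ.restrOpen V hV ∈ levelAtlas y := fun w hw => hφ w hw.1
    have hz' : z ∈ (φ.restrOpen V hV).source := ⟨hzφ, hz⟩
    refine ⟨_, ⟨φ.restrOpen V hV, hF hm, z, hz', rfl⟩, mem_connectedComponentIn ⟨hz', rfl⟩,
      fun w hw => ?_⟩
    have h := connectedComponentIn_subset _ _ hw
    refine ⟨h.1.2, ?_⟩
    have h2 : ((φ.restrOpen V hV) w).2 = ((φ.restrOpen V hV) z).2 := h.2
    rwa [hm w h.1, hm z hz'] at h2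
  apply le_antisymm
  · refine le_inf (fun V hV => ?_) ?_
    · refine (@isOpen_iff_forall_mem_open _ F.leafTopology V).2 fun z hz => ?_
      obtain ⟨P, hP, hzP, hPV⟩ := key V hV z hz
      exact ⟨P, hPV.trans inter_subset_left, TopologicalSpace.isOpen_generateFrom_of_mem hP, hzP⟩
    · rintro V ⟨s, -, rfl⟩
      refine (@isOpen_iff_forall_mem_open _ F.leafTopology _).2 fun z hz => ?_
      obtain ⟨P, hP, hzP, hPV⟩ := key univ isOpen_univ z trivial
      refine ⟨P, fun w hw => ?_, TopologicalSpace.isOpen_generateFrom_of_mem hP, hzP⟩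
      have : y w = y z := (hPV hw).2
      rw [mem_preimage, this]; exact hz
  · refine le_generateFrom ?_
    rintro Q ⟨ψ, hψ, x, hx, rfl⟩
    refine (@isOpen_iff_forall_mem_open _ (levelTopology y) _).2 fun z hz => ?_
    have hzS := connectedComponentIn_subset _ _ hz
    obtain ⟨φ, hφ, hzφ⟩ := hy z
    obtain ⟨g, h, hgh, -⟩ := F.maximal.prop.change φ (hF hφ) ψ hψ
    -- On the overlap the transverse coordinate of `ψ` is a function of `y`. Hence a short
    -- horizontal segment of `φ` through `z` stays in the level of `ψ` and, being connected, in the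
    -- plaque.
    have hψy : ∀ w ∈ φ.source ∩ ψ.source, (ψ w).2 = h (y w) := by
      intro w hw
      have := hgh (φ w) (by simp [φ.map_source hw.1, φ.left_inv hw.1, hw.2])
      simp only [OpenPartialHomeomorph.coe_trans, Function.comp, φ.left_inv hw.1] at this
      rw [this, hφ w hw.1]
    have hO : IsOpen (φ.symm.trans ψ).source := (φ.symm.trans ψ).open_source
    have hzO : φ z ∈ (φ.symm.trans ψ).source := by
      simp [φ.map_source hzφ, φ.left_inv hzφ, hzS.1]
    obtain ⟨ε, hε, hball⟩ := Metric.isOpen_iff.1 hO _ hzO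
    set B := Metric.ball (φ z) ε
    have hBO : ∀ p ∈ B, p ∈ φ.target ∧ φ.symm p ∈ ψ.source := fun p hp => by
      have := hball hp
      simpa using this
    have hBeq : B = Metric.ball (φ z).1 ε ×ˢ Metric.ball (φ z).2 ε := (ball_prod_same _ _ _).symm
    have hW : IsOpen (φ.source ∩ φ ⁻¹' B) := φ.isOpen_inter_preimage Metric.isOpen_ball
    have hconn : IsPreconnected (φ.symm '' (Metric.ball (φ z).1 ε ×ˢ {(φ z).2})) := by
      refine IsPreconnected.image ?_ _ (φ.continuousOn_symm.mono ?_)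
      · exact (convex_ball _ _).isPreconnected.prod isPreconnected_singleton
      · rintro p ⟨hp1, hp2⟩
        refine (hBO p ?_).1
        rw [hBeq]
        refine ⟨hp1, ?_⟩
        rw [mem_singleton_iff.1 hp2]; exact Metric.mem_ball_self hε
    refine ⟨(φ.source ∩ φ ⁻¹' B) ∩ y ⁻¹' {y z}, ?_, isOpen_levelTopology_inter hW _,
      ⟨⟨hzφ, Metric.mem_ball_self hε⟩, rfl⟩⟩
    have hsub : φ.symm '' (Metric.ball (φ z).1 ε ×ˢ {(φ z).2}) ⊆
        ψ.source ∩ {w | (ψ w).2 = (ψ x).2} := by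
      rintro _ ⟨p, ⟨hp1, hp2⟩, rfl⟩
      have hpB : p ∈ B := by
        rw [hBeq]
        refine ⟨hp1, ?_⟩
        rw [mem_singleton_iff.1 hp2]; exact Metric.mem_ball_self hε
      obtain ⟨ht, hs⟩ := hBO p hpB
      refine ⟨hs, ?_⟩
      have e1 : y (φ.symm p) = y z := by
        rw [← hφ _ (φ.map_target ht), ← hφ z hzφ, φ.right_inv ht]; exact hp2
      have e2 := hψy z ⟨hzφ, hzS.1⟩
      have e3 : (ψ z).2 = (ψ x).2 := hzS.2
      rw [mem_ofPred_eq, hψy _ ⟨φ.map_target ht, hs⟩, e1, ← e2, e3]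
    have hzmem : z ∈ φ.symm '' (Metric.ball (φ z).1 ε ×ˢ {(φ z).2}) :=
      ⟨φ z, ⟨Metric.mem_ball_self hε, rfl⟩, φ.left_inv hzφ⟩
    rw [connectedComponentIn_eq hz]
    refine Subset.trans ?_ (hconn.subset_connectedComponentIn hzmem hsub)
    rintro w ⟨⟨hw, hwB⟩, hwy⟩
    refine ⟨φ w, ⟨?_, ?_⟩, φ.left_inv hw⟩
    · have : φ w ∈ B := hwB
      rw [hBeq] at this
      exact this.1
    · rw [mem_singleton_iff, hφ w hw, hφ z hzφ]; exact hwy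

theorem induced_levelTopology_of_subset_level {y : M → ℝ} {l : Set M} {c : ℝ}
    (hl : ∀ z ∈ l, y z = c) :
    TopologicalSpace.induced (Subtype.val : l → M) (levelTopology y) =
      (inferInstance : TopologicalSpace l) := by
  rw [levelTopology, induced_inf, induced_compose]
  have : y ∘ (Subtype.val : l → M) = fun _ => c := funext fun z => hl z z.2
  rw [this, @induced_const _ _ ⊥ _, inf_top_eq]
  rfl

theorem IsPathConnected.levelTopology {y : M → ℝ} {l : Set M} {c : ℝ}
    (hc : IsPathConnected l) (hl : ∀ z ∈ l, y z = c) : @IsPathConnected M (levelTopology y) l := by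
  obtain ⟨x, hx, h⟩ := hc
  refine ⟨x, hx, fun {z} hz => ?_⟩
  obtain ⟨γ, hγ⟩ := h hz
  let γ' : @Path M (_root_.levelTopology y) x z :=
    @Path.mk M (_root_.levelTopology y) x z
      (@ContinuousMap.mk _ _ _ (_root_.levelTopology y) γ (by
        refine continuous_inf_rng.2 ⟨γ.continuous, (continuous_induced_rng (t₂ := ⊥)).2 ?_⟩
        have : y ∘ γ = fun _ => c := funext fun t => hl _ (hγ t)
        rw [this]
        exact @continuous_const _ _ _ ⊥ _)) γ.source γ.target
  exact ⟨γ', hγ⟩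

/-- If the fibres of `k` are path connected, lie in level sets of `y` and are relatively open
there, then they are the path components for the level topology. -/
theorem pathComponent_levelTopology {κ : Type*} {y : M → ℝ} {k : M → κ}
    (hky : ∀ z w, k z = k w → y z = y w)
    (hopen : ∀ z, ∃ V, IsOpen V ∧ z ∈ V ∧ ∀ w ∈ V, y w = y z → k w = k z)
    (hpath : ∀ z, IsPathConnected (k ⁻¹' {k z})) (x : M) :
    @pathComponent M (levelTopology y) x = k ⁻¹' {k x} := by
  have hloc : ∀ s : Set κ, IsOpen[levelTopology y] (k ⁻¹' s) := by
    intro s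
    refine (@isOpen_iff_forall_mem_open _ (levelTopology y) _).2 fun z hz => ?_
    obtain ⟨V, hV, hzV, h⟩ := hopen z
    refine ⟨V ∩ y ⁻¹' {y z}, fun w hw => ?_, isOpen_levelTopology_inter hV _, hzV, rfl⟩
    have := h w hw.1 hw.2
    rwa [mem_preimage, this]
  apply Subset.antisymm
  · rintro z ⟨γ⟩
    have hcl : @IsClopen M (levelTopology y) (k ⁻¹' {k x}) :=
      ⟨(@isOpen_compl_iff _ _ (levelTopology y)).1 (hloc {k x}ᶜ), hloc _⟩
    have := @IsClopen.preimage _ _ _ (levelTopology y) _ hcl _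
      (@Path.continuous _ (levelTopology y) _ _ γ)
    rcases isClopen_iff.1 this with h | h
    · exact absurd (show (0 : unitInterval) ∈ γ ⁻¹' (k ⁻¹' {k x}) by simp) (by rw [h]; simp)
    · have h1 : (1 : unitInterval) ∈ γ ⁻¹' (k ⁻¹' {k x}) := by rw [h]; trivial
      simpa using h1
  · have := (hpath x).levelTopology (y := y) (c := y x) (fun z hz => hky _ _ hz)
    intro z hz
    exact @JoinedIn.joined _ (levelTopology y) _ _ _
      (@IsPathConnected.joinedIn _ (levelTopology y) _ this x rfl z hz)

end FoliationByFunction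

/-! ### The long ray and its ramp functions -/

section LongRay

/-- The index set `ω₁`. -/
abbrev Omega1 : Type := (Ordinal.omega 1 : Ordinal.{0}).ToType

instance : Nonempty Omega1 := Ordinal.nonempty_toType_iff.2 (Ordinal.omega_pos 1).ne'

noncomputable instance : OrderBot Omega1 := WellFoundedLT.toOrderBot Omega1

theorem Omega1.countable_Iio (α : Omega1) : (Iio α).Countable := by
  have h : Cardinal.mk Omega1 = Cardinal.aleph 1 := by
    rw [Cardinal.mk_toType, Ordinal.card_omega]
  have := Cardinal.mk_Iio_lt α (by rw [h, Cardinal.ord_aleph, Ordinal.type_toType])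
  rwa [h, Cardinal.lt_aleph_one_iff, Cardinal.le_aleph0_iff_set_countable] at this

instance : NoMaxOrder Omega1 := by
  refine ⟨fun α => ?_⟩
  by_contra! hc
  have h1 : (univ : Set Omega1).Countable :=
    ((Omega1.countable_Iio α).insert α).mono fun β _ => (hc β).eq_or_lt
  have h2 := Cardinal.le_aleph0_iff_set_countable.2 h1
  rw [Cardinal.mk_univ, Cardinal.mk_toType, Ordinal.card_omega] at h2
  exact h2.not_gt (Cardinal.aleph0_lt_aleph_one)

/-- This is `1 + ω₁ = ω₁`: prepending a point to `ω₁` gives an isomorphic order, in which that point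
becomes `⊥`. -/
theorem Omega1.exists_strictMono_range_compl_bot :
    ∃ j : Omega1 → Omega1, StrictMono j ∧ range j = {⊥}ᶜ := by
  have h : Ordinal.type (Sum.Lex (emptyRelation (α := Unit)) ((· < ·) : Omega1 → Omega1 → Prop)) =
      Ordinal.type ((· < ·) : Omega1 → Omega1 → Prop) := by
    rw [Ordinal.type_sum_lex, Ordinal.type_toType]
    simp [Ordinal.one_add_of_omega0_le (Ordinal.omega0_le_omega 1)]
  obtain ⟨e⟩ := Ordinal.type_eq.1 h
  have hbot : e (Sum.inl ()) = ⊥ := by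
    obtain ⟨z, hz⟩ := e.surjective ⊥
    rcases z with ⟨⟩ | z
    · exact hz
    · have : e (Sum.inl ()) < e (Sum.inr z) := e.map_rel_iff.2 (Sum.Lex.sep _ _)
      rw [hz] at this
      exact absurd this not_lt_bot
  refine ⟨fun β => e (Sum.inr β), fun β γ hβγ => e.map_rel_iff.2 (Sum.Lex.inr hβγ), ?_⟩
  ext β
  obtain ⟨z, rfl⟩ := e.surjective β
  rw [← hbot]
  rcases z with ⟨⟩ | z
  · simp
  · simp

namespace ClosedLongRay

instance : OrderTopology ClosedLongRay := ⟨rfl⟩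

/-- The first coordinate on the long ray. -/
def idx (p : ClosedLongRay) : Omega1 := (ofLex p).1

/-- The second coordinate on the long ray. -/
def par (p : ClosedLongRay) : ℝ := (ofLex p).2

/-- The point of the long ray with given coordinates. -/
def mk (β : Omega1) (s : ℝ) (h0 : 0 ≤ s) (h1 : s < 1) : ClosedLongRay := toLex (β, ⟨s, h0, h1⟩)

@[simp] theorem idx_mk (β : Omega1) (s : ℝ) (h0 : 0 ≤ s) (h1 : s < 1) : (mk β s h0 h1).idx = β := rfl

@[simp] theorem par_mk (β : Omega1) (s : ℝ) (h0 : 0 ≤ s) (h1 : s < 1) : (mk β s h0 h1).par = s := rfl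

theorem par_nonneg (p : ClosedLongRay) : 0 ≤ p.par := (ofLex p).2.2.1

theorem par_lt_one (p : ClosedLongRay) : p.par < 1 := (ofLex p).2.2.2

theorem ext' {p q : ClosedLongRay} (h1 : p.idx = q.idx) (h2 : p.par = q.par) : p = q :=
  Prod.ext h1 (Subtype.ext h2)

theorem lt_iff {p q : ClosedLongRay} : p < q ↔ p.idx < q.idx ∨ p.idx = q.idx ∧ p.par < q.par :=
  Prod.Lex.lt_iff

theorem isMin_iff {p : ClosedLongRay} : IsMin p ↔ p.idx = ⊥ ∧ p.par = 0 := by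
  constructor
  · intro h
    by_contra hc
    have : mk ⊥ 0 le_rfl one_pos < p := by
      rw [lt_iff]
      rcases (bot_le : ⊥ ≤ p.idx).lt_or_eq with h1 | h1
      · exact Or.inl h1
      · refine Or.inr ⟨h1, lt_of_le_of_ne p.par_nonneg fun h2 => hc ⟨h1.symm, h2.symm⟩⟩
    exact h.not_lt this
  · rintro ⟨h1, h2⟩
    refine isMin_iff_forall_not_lt.2 fun q hq => ?_
    rw [lt_iff, h1, h2] at hq
    rcases hq with h | h
    · exact not_lt_bot h
    · exact absurd h.2 (not_lt.2 q.par_nonneg)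

/-- The monotone function on the long ray that runs through `[0, 1]` on the `β`-th interval. -/
noncomputable def ramp (β : Omega1) (p : ClosedLongRay) : ℝ :=
  if p.idx < β then 0 else if p.idx = β then p.par else 1

theorem ramp_of_idx_lt {β : Omega1} {p : ClosedLongRay} (h : p.idx < β) : ramp β p = 0 := if_pos h

theorem ramp_of_idx_eq {β : Omega1} {p : ClosedLongRay} (h : p.idx = β) : ramp β p = p.par := by
  rw [ramp, if_neg h.not_lt, if_pos h]

theorem ramp_of_lt_idx {β : Omega1} {p : ClosedLongRay} (h : β < p.idx) : ramp β p = 1 := by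
  rw [ramp, if_neg h.not_gt, if_neg h.ne']

theorem ramp_mem_Icc (β : Omega1) (p : ClosedLongRay) : ramp β p ∈ Icc (0 : ℝ) 1 := by
  unfold ramp
  split_ifs
  · simp
  · exact ⟨p.par_nonneg, p.par_lt_one.le⟩
  · simp

theorem lt_ramp_iff {p q : ClosedLongRay} : p.par < ramp p.idx q ↔ p < q := by
  rw [lt_iff]
  rcases lt_trichotomy q.idx p.idx with h | h | h
  · simp [ramp_of_idx_lt h, h.not_gt, h.ne', p.par_nonneg]
  · simp [ramp_of_idx_eq h, h]
  · simp [ramp_of_lt_idx h, h, p.par_lt_one]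

theorem ramp_mono (β : Omega1) : Monotone (ramp β) := by
  intro p q hpq
  rcases hpq.eq_or_lt with rfl | hpq
  · exact le_rfl
  rcases lt_trichotomy p.idx β with h | h | h
  · rw [ramp_of_idx_lt h]; exact (ramp_mem_Icc _ _).1
  · rw [ramp_of_idx_eq h, ← h]; exact (lt_ramp_iff.2 hpq).le
  · have : β < q.idx := by
      rcases lt_iff.1 hpq with h' | h'
      · exact h.trans h'
      · exact h.trans_eq h'.1
    rw [ramp_of_lt_idx h, ramp_of_lt_idx this]

/-- A monotone surjection onto `[0, 1]` is continuous; the value 1 is attained because `ω₁` has no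
largest element. -/
theorem continuous_ramp (β : Omega1) : Continuous (ramp β) := by
  have : Continuous fun p => (⟨ramp β p, ramp_mem_Icc β p⟩ : Icc (0 : ℝ) 1) := by
    refine Monotone.continuous_of_surjective (fun p q h => ramp_mono β h) ?_
    rintro ⟨s, h0, h1⟩
    rcases h1.eq_or_lt with rfl | h1
    · obtain ⟨γ, hγ⟩ := exists_gt β
      exact ⟨mk γ 0 le_rfl one_pos, Subtype.ext (ramp_of_lt_idx (by simpa using hγ))⟩
    · exact ⟨mk β s h0 h1, Subtype.ext (ramp_of_idx_eq (idx_mk β s h0 h1))⟩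
  exact continuous_subtype_val.comp this

theorem le_topology_of_continuous_ramp (t : TopologicalSpace ClosedLongRay)
    (hc : ∀ β, Continuous[t, inferInstance] (ramp β)) : t ≤ Preorder.topology ClosedLongRay := by
  refine le_generateFrom ?_
  rintro _ ⟨a, rfl | rfl⟩
  · have : Ioi a = ramp a.idx ⁻¹' (Ioi a.par) := by
      ext q
      exact lt_ramp_iff.symm
    rw [this]
    exact (hc _).isOpen_preimage _ isOpen_Ioi
  -- The ramp of `a.idx` alone does not suffice: if `a.par = 0`, its preimage is empty and the
  -- earlier ramps exhaust `Iio a`.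
  · have : Iio a = ramp a.idx ⁻¹' (Iio a.par) ∪ ⋃ β : Iio a.idx, ramp β ⁻¹' (Iio 1) := by
      ext q
      simp only [mem_Iio, mem_union, mem_preimage, mem_iUnion, Subtype.exists, exists_prop]
      constructor
      · intro h
        rcases lt_iff.1 h with h | h
        · exact Or.inr ⟨q.idx, h, by rw [ramp_of_idx_eq rfl]; exact q.par_lt_one⟩
        · left; rw [ramp_of_idx_eq h.1]; exact h.2
      · rintro (h | ⟨β, hβ, h⟩)
        · by_contra hc
          refine h.not_ge ?_
          have := ramp_mono a.idx (not_lt.1 hc)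
          rwa [ramp_of_idx_eq rfl] at this
        · by_contra hc
          have := ramp_mono β (not_lt.1 hc)
          rw [ramp_of_lt_idx hβ] at this
          exact h.not_ge this
    rw [this]
    exact @IsOpen.union _ _ _ t ((hc _).isOpen_preimage _ isOpen_Iio)
      (@isOpen_iUnion _ _ t _ fun β => (hc _).isOpen_preimage _ isOpen_Iio)

/-- The ramps determine the order topology, which lets the long ray be glued to the plane through
real-valued functions. -/
theorem isInducing_ramp : IsInducing fun (p : ClosedLongRay) (β : Omega1) => ramp β p := by
  refine ⟨le_antisymm ((continuous_pi continuous_ramp).le_induced) ?_⟩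
  refine le_topology_of_continuous_ramp _ fun β => ?_
  have h := @continuous_induced_dom _ _ (fun (p : ClosedLongRay) (β : Omega1) => ramp β p)
    inferInstance
  exact @Continuous.comp _ _ _ (TopologicalSpace.induced _ _) _ _ _ _ (continuous_apply β) h

/-- The long ray is homeomorphic to its part beyond the first interval. -/
theorem exists_isEmbedding_range :
    ∃ J : ClosedLongRay → ClosedLongRay, IsEmbedding J ∧ range J = {p | p.idx ≠ ⊥} := by
  obtain ⟨j, hj, hr⟩ := Omega1.exists_strictMono_range_compl_bot
  set J : ClosedLongRay → ClosedLongRay := fun p => mk (j p.idx) p.par p.par_nonneg p.par_lt_one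
  have hJr : range J = {p | p.idx ≠ ⊥} := by
    ext p
    constructor
    · rintro ⟨q, rfl⟩
      have : j q.idx ∈ range j := ⟨_, rfl⟩
      rw [hr] at this
      exact this
    · intro hp
      have : p.idx ∈ range j := by rw [hr]; exact hp
      obtain ⟨β, hβ⟩ := this
      exact ⟨mk β p.par p.par_nonneg p.par_lt_one, ext' hβ rfl⟩
  refine ⟨J, StrictMono.isEmbedding_of_ordConnected ?_ ?_, hJr⟩
  · intro p q hpq
    rw [lt_iff] at hpq ⊢
    exact hpq.imp (fun h => hj h) (fun h => ⟨congrArg j h.1, h.2⟩)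
  · rw [hJr]
    refine ⟨fun p hp q hq r hr h => hp ?_⟩
    rcases hr.1.eq_or_lt with rfl | h'
    · exact h
    · rcases lt_iff.1 h' with h1 | h1
      · rw [h] at h1; exact absurd h1 not_lt_bot
      · rw [h1.1, h]

end ClosedLongRay

end LongRay

/-! ### A tower of functions of length `ω₁` -/

section Tower

theorem exists_continuous_eventually_add_one_le {ι : Type*} [Countable ι] (h : ι → ℝ → ℝ)
    (hc : ∀ i, Continuous (h i)) :
    ∃ g : ℝ → ℝ, Continuous g ∧ ∀ i, ∀ᶠ t in atTop, h i t + 1 ≤ g t := by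
  obtain ⟨e, he⟩ := exists_injective_nat ι
  -- Each summand is switched on between `e i` and `e i + 1`, so only finitely many act near any
  -- `t`, while nonnegativity keeps the sum above each of them.
  set c : ι → ℝ → ℝ := fun i t => max 0 (min 1 (t - e i)) * (|h i t| + 1)
  have hc0 : ∀ i t, 0 ≤ c i t := fun i t => by positivity
  have hloc : LocallyFinite fun i => Function.support (c i) := by
    intro t
    obtain ⟨n, hn⟩ := exists_nat_gt t
    refine ⟨Iio n, Iio_mem_nhds hn, ?_⟩
    refine ((finite_lt_nat n).preimage he.injOn).subset ?_
    rintro i ⟨s, hs, hsn⟩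
    by_contra hi
    refine hs ?_
    have h1 : (n : ℝ) ≤ e i := by exact_mod_cast not_lt.1 hi
    have h2 : s - e i ≤ 0 := by have := mem_Iio.1 hsn; linarith
    simp [c, max_eq_left ((min_le_right _ _).trans h2)]
  refine ⟨fun t => ∑ᶠ i, c i t, continuous_finsum (fun i => ?_) hloc, fun i => ?_⟩
  · have := hc i
    fun_prop
  · filter_upwards [eventually_ge_atTop ((e i : ℝ) + 1)] with t ht
    have h1 : c i t ≤ ∑ᶠ i, c i t := single_le_finsum i (hloc.point_finite t) fun j => hc0 j t
    refine le_trans ?_ h1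
    have : max 0 (min 1 (t - e i)) = 1 := by
      rw [min_eq_left (by linarith), max_eq_right zero_le_one]
    simp only [c, this, one_mul]
    linarith [le_abs_self (h i t)]

/-- A tower of `ω₁` continuous functions, increasing at infinity. -/
noncomputable def growthTower (γ : Omega1) : {g : ℝ → ℝ // Continuous g} :=
  haveI : Countable (Iio γ) := (Omega1.countable_Iio γ).to_subtype
  let H := exists_continuous_eventually_add_one_le (fun β : Iio γ => (growthTower β.1).1)
    fun β => (growthTower β.1).2
  ⟨H.choose, H.choose_spec.1⟩
termination_by γ
decreasing_by all_goals exact mem_Iio.1 (Subtype.coe_prop _)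

theorem growthTower_eventually {β γ : Omega1} (h : β < γ) :
    ∀ᶠ t in atTop, (growthTower β).1 t + 1 ≤ (growthTower γ).1 t := by
  have : Countable (Iio γ) := (Omega1.countable_Iio γ).to_subtype
  rw [growthTower.eq_1 γ]
  exact (exists_continuous_eventually_add_one_le (fun β : Iio γ => (growthTower β.1).1)
    fun β => (growthTower β.1).2).choose_spec.2 ⟨β, h⟩

/-- The functions of the tower, as functions of the distance to the long ray. -/
noncomputable def tower (β : Omega1) (y : ℝ) : ℝ := (growthTower β).1 |y|⁻¹

theorem continuousAt_tower (β : Omega1) {y : ℝ} (hy : y ≠ 0) : ContinuousAt (tower β) y :=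
  (growthTower β).2.continuousAt.comp (continuous_abs.continuousAt.inv₀ (abs_ne_zero.2 hy))

theorem tower_eventually {β γ : Omega1} (h : β < γ) :
    ∀ᶠ y in 𝓝[≠] (0 : ℝ), tower β y + 1 ≤ tower γ y := by
  have : Tendsto (fun y : ℝ => |y|⁻¹) (𝓝[≠] 0) atTop := by
    simpa using tendsto_norm_inv_nhdsNE_zero_atTop (α := ℝ)
  exact this.eventually (growthTower_eventually h)

end Tower

/-! ### The long plane and its topology -/

/-- The plane in which the axis `y = 0` is replaced by the open long ray. -/
def LongPlane : Type := {p : ℝ × ℝ // p.2 ≠ 0} ⊕ OpenLongRay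

namespace LongPlane

/-- The points off the long ray. -/
def pt (x y : ℝ) (hy : y ≠ 0) : LongPlane := Sum.inl ⟨(x, y), hy⟩

/-- The points on the long ray. -/
def ray (p : OpenLongRay) : LongPlane := Sum.inr p

theorem pt_or_ray (z : LongPlane) : (∃ x y hy, z = pt x y hy) ∨ ∃ p, z = ray p := by
  rcases z with ⟨⟨x, y⟩, hy⟩ | p
  · exact Or.inl ⟨x, y, hy, rfl⟩
  · exact Or.inr ⟨p, rfl⟩

/-- The second coordinate. -/
def height (z : LongPlane) : ℝ := Sum.elim (fun p => p.1.2) (fun _ => 0) z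

/-- The first coordinate, off the long ray. -/
def abscissa (z : LongPlane) : ℝ := Sum.elim (fun p => p.1.1) (fun _ => 0) z

/-- The truncation to `[0, 1]`. -/
noncomputable def clamp (x : ℝ) : ℝ := max 0 (min 1 x)

theorem clamp_mono : Monotone clamp := fun _ _ h => max_le_max le_rfl (min_le_min le_rfl h)

theorem continuous_clamp : Continuous clamp := by unfold clamp; fun_prop

theorem clamp_mem_Icc (x : ℝ) : clamp x ∈ Icc (0 : ℝ) 1 :=
  ⟨le_max_left _ _, max_le zero_le_one (min_le_left _ _)⟩

theorem clamp_of_nonpos {x : ℝ} (h : x ≤ 0) : clamp x = 0 := max_eq_left ((min_le_right _ _).trans h)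

theorem clamp_of_one_le {x : ℝ} (h : 1 ≤ x) : clamp x = 1 := by
  rw [clamp, min_eq_left h, max_eq_right zero_le_one]

theorem clamp_of_mem {x : ℝ} (h : x ∈ Icc (0 : ℝ) 1) : clamp x = x := by
  rw [clamp, min_eq_right h.2, max_eq_right h.1]

theorem lt_of_clamp_lt {x r : ℝ} (h : clamp x < r) (hr : r < 1) : x < r := by
  by_contra! hc
  rcases le_total 1 x with h1 | h1
  · rw [clamp_of_one_le h1] at h; linarith
  · have : min 1 x ≤ clamp x := le_max_right _ _
    rw [min_eq_right h1] at this; linarith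

theorem lt_of_lt_clamp {x r : ℝ} (h : r < clamp x) (hr : 0 < r) : r < x := by
  by_contra! hc
  have : clamp x ≤ max 0 x := max_le_max le_rfl (min_le_right _ _)
  exact absurd (h.trans_le this) (not_lt.2 (max_le hr.le hc))

/-- The function on the long plane that crosses `[0, 1]` along the `β`-th interval. -/
noncomputable def ramp (β : Omega1) (z : LongPlane) : ℝ :=
  Sum.elim (fun p => clamp (p.1.1 - tower β p.1.2)) (fun p => p.1.ramp β) z

/-- A continuous function with values in `[0, 1)` that vanishes at `0` only. -/
noncomputable def fade (y : ℝ) : ℝ := |y| / (1 + |y|)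

theorem continuous_fade : Continuous fade :=
  continuous_abs.div (continuous_const.add continuous_abs) fun y => by positivity

theorem fade_zero : fade 0 = 0 := by simp [fade]

theorem fade_nonneg (y : ℝ) : 0 ≤ fade y := by unfold fade; positivity

theorem fade_pos {y : ℝ} (h : y ≠ 0) : 0 < fade y := by
  have := abs_pos.2 h
  unfold fade; positivity

theorem fade_lt_one (y : ℝ) : fade y < 1 := by
  have := abs_nonneg y
  rw [fade, div_lt_one (by linarith)]; linarith

/-- A function that is strictly increasing on the horizontal lines off the long ray, and vanishes
on the long ray. -/
noncomputable def drift (z : LongPlane) : ℝ := fade (height z) * Real.sigmoid (abscissa z)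

section values
variable (x y : ℝ) (hy : y ≠ 0) (p : OpenLongRay) (β : Omega1)
@[simp] theorem height_pt : height (pt x y hy) = y := rfl
@[simp] theorem height_ray : height (ray p) = 0 := rfl
@[simp] theorem abscissa_pt : abscissa (pt x y hy) = x := rfl
@[simp] theorem ramp_pt : ramp β (pt x y hy) = clamp (x - tower β y) := rfl
@[simp] theorem ramp_ray : ramp β (ray p) = p.1.ramp β := rfl
@[simp] theorem drift_pt : drift (pt x y hy) = fade y * Real.sigmoid x := rfl
@[simp] theorem drift_ray : drift (ray p) = 0 := by simp [drift, fade_zero]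
end values

theorem ramp_mem_Icc (β : Omega1) (z : LongPlane) : ramp β z ∈ Icc (0 : ℝ) 1 := by
  rcases pt_or_ray z with ⟨x, y, hy, rfl⟩ | ⟨p, rfl⟩
  · exact clamp_mem_Icc _
  · exact ClosedLongRay.ramp_mem_Icc _ _

/-- Off the ray, `height` and `drift` recover both plane coordinates; on the ray they both vanish
and the ramps take over. All convergence thus reduces to limits of real functions. -/
noncomputable instance : TopologicalSpace LongPlane :=
  TopologicalSpace.induced (fun z => (height z, drift z, fun β => ramp β z)) inferInstance

theorem tendsto_nhds_iff {ι : Type*} {l : Filter ι} {f : ι → LongPlane} {z : LongPlane} :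
    Tendsto f l (𝓝 z) ↔ Tendsto (fun i => height (f i)) l (𝓝 (height z)) ∧
      Tendsto (fun i => drift (f i)) l (𝓝 (drift z)) ∧
      ∀ β, Tendsto (fun i => ramp β (f i)) l (𝓝 (ramp β z)) := by
  rw [nhds_induced, tendsto_comap_iff, nhds_prod_eq, tendsto_prod_iff', nhds_prod_eq,
    tendsto_prod_iff', tendsto_pi_nhds]
  rfl

theorem continuous_height : Continuous height :=
  continuous_iff_continuousAt.2 fun _ => (tendsto_nhds_iff.1 tendsto_id).1

theorem continuous_drift : Continuous drift :=
  continuous_iff_continuousAt.2 fun _ => (tendsto_nhds_iff.1 tendsto_id).2.1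

theorem continuous_ramp (β : Omega1) : Continuous (ramp β) :=
  continuous_iff_continuousAt.2 fun _ => (tendsto_nhds_iff.1 tendsto_id).2.2 β

theorem continuous_pt : Continuous fun p : {p : ℝ × ℝ // p.2 ≠ 0} => pt p.1.1 p.1.2 p.2 := by
  refine continuous_iff_continuousAt.2 fun p => tendsto_nhds_iff.2 ⟨?_, ?_, fun β => ?_⟩
  · exact (continuous_snd.comp continuous_subtype_val).continuousAt
  · have : Continuous fun p : {p : ℝ × ℝ // p.2 ≠ 0} => fade p.1.2 * Real.sigmoid p.1.1 :=
      (continuous_fade.comp (by fun_prop)).mul (_root_.continuous_sigmoid.comp (by fun_prop))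
    exact this.continuousAt
  · refine (continuous_clamp.tendsto _).comp (Tendsto.sub ?_ ?_)
    · exact (continuous_fst.comp continuous_subtype_val).continuousAt
    · exact (continuousAt_tower β p.2).tendsto.comp
        (continuous_snd.comp continuous_subtype_val).continuousAt

theorem isEmbedding_ray : IsEmbedding ray := by
  have hc : Continuous ray := by
    refine continuous_iff_continuousAt.2 fun p => tendsto_nhds_iff.2 ⟨?_, ?_, fun β => ?_⟩
    · exact tendsto_const_nhds
    · simp
    · exact ((ClosedLongRay.continuous_ramp β).comp continuous_subtype_val).continuousAt
  refine ⟨?_, Sum.inr_injective⟩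
  refine IsInducing.of_comp hc (continuous_pi continuous_ramp) ?_
  exact ClosedLongRay.isInducing_ramp.comp IsInducing.subtypeVal

theorem isEmbedding_pt {y : ℝ} (hy : y ≠ 0) : IsEmbedding fun x => pt x y hy := by
  have hc : Continuous fun x => pt x y hy := continuous_pt.comp
    (Continuous.subtype_mk (continuous_id.prodMk continuous_const) fun _ => hy)
  refine IsEmbedding.of_comp hc continuous_drift ?_
  have : drift ∘ (fun x => pt x y hy) = (Homeomorph.mulLeft₀ (fade y) (fade_pos hy).ne') ∘
      Real.sigmoid := rfl
  rw [this]
  refine (Homeomorph.isEmbedding _).comp ?_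
  exact Real.sigmoid_strictMono.isEmbedding_of_ordConnected
    (by rw [Real.range_sigmoid]; exact ordConnected_Ioo)

/-- The points of the open long ray inside an interval. -/
def openMk (δ : Omega1) (r : ℝ) (h0 : 0 < r) (h1 : r < 1) : OpenLongRay :=
  ⟨ClosedLongRay.mk δ r h0.le h1, fun h => h0.ne' (ClosedLongRay.isMin_iff.1 h).2⟩

theorem ramp_openMk (δ : Omega1) (r : ℝ) (h0 : 0 < r) (h1 : r < 1) :
    (openMk δ r h0 h1).1.ramp δ = r := ClosedLongRay.ramp_of_idx_eq rfl

open Classical in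
/-- A curve that crosses the long ray at a given point. -/
noncomputable def curve (δ : Omega1) (r : ℝ) (h0 : 0 < r) (h1 : r < 1) (y : ℝ) : LongPlane :=
  if h : y = 0 then ray (openMk δ r h0 h1) else pt (tower δ y + r) y h

section curve
variable {δ : Omega1} {r : ℝ} (h0 : 0 < r) (h1 : r < 1)

theorem curve_zero : curve δ r h0 h1 0 = ray (openMk δ r h0 h1) := by simp [curve]

theorem curve_of_ne {y : ℝ} (hy : y ≠ 0) : curve δ r h0 h1 y = pt (tower δ y + r) y hy := by
  simp [curve, hy]

@[simp] theorem height_curve (y : ℝ) : height (curve δ r h0 h1 y) = y := by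
  rcases eq_or_ne y 0 with rfl | hy
  · rw [curve_zero]; rfl
  · rw [curve_of_ne _ _ hy]; rfl

theorem abs_drift_le (z : LongPlane) : |drift z| ≤ fade (height z) := by
  rw [drift, abs_mul, abs_of_nonneg (fade_nonneg _), abs_of_nonneg (Real.sigmoid_nonneg _)]
  exact mul_le_of_le_one_right (fade_nonneg _) (Real.sigmoid_le_one _)

theorem tendsto_drift_zero {l : Filter LongPlane} (h : Tendsto height l (𝓝 0)) :
    Tendsto drift l (𝓝 0) := by
  refine squeeze_zero_norm abs_drift_le ?_
  rw [← fade_zero]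
  exact (continuous_fade.tendsto 0).comp h

/-- The growth of the tower enters here: near `y = 0` the ramps along the curve are constant, equal
to 1 for `β < δ`, to `r` for `β = δ` and to 0 for `β > δ`, exactly as at the limit point. -/
theorem continuousAt_curve : ContinuousAt (curve δ r h0 h1) 0 := by
  rw [ContinuousAt, tendsto_nhds_iff]
  have hh : Tendsto (fun y => height (curve δ r h0 h1 y)) (𝓝 0) (𝓝 0) := by
    simp only [height_curve]
    exact tendsto_id
  refine ⟨by simpa using hh, ?_, fun β => ?_⟩
  · rw [curve_zero, drift_ray]
    exact (tendsto_drift_zero (l := map (curve δ r h0 h1) (𝓝 0)) hh)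
  · have : ∀ᶠ y in 𝓝[≠] (0 : ℝ), ramp β (curve δ r h0 h1 y) = ramp β (curve δ r h0 h1 0) := by
      rw [curve_zero, ramp_ray]
      rcases lt_trichotomy β δ with h | rfl | h
      · filter_upwards [tower_eventually h, self_mem_nhdsWithin] with y hy hy0
        replace hy0 : y ≠ 0 := hy0
        rw [curve_of_ne _ _ hy0, ramp_pt, clamp_of_one_le (by linarith)]
        exact (ClosedLongRay.ramp_of_lt_idx h).symm
      · filter_upwards [self_mem_nhdsWithin] with y hy0
        replace hy0 : y ≠ 0 := hy0
        rw [curve_of_ne _ _ hy0, ramp_pt, add_sub_cancel_left, clamp_of_mem ⟨h0.le, h1.le⟩]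
        exact (ramp_openMk _ _ _ _).symm
      · filter_upwards [tower_eventually h, self_mem_nhdsWithin] with y hy hy0
        replace hy0 : y ≠ 0 := hy0
        rw [curve_of_ne _ _ hy0, ramp_pt, clamp_of_nonpos (by linarith)]
        exact (ClosedLongRay.ramp_of_idx_lt h).symm
    exact continuousAt_iff_punctured_nhds.2 (tendsto_const_nhds.congr' (this.mono fun _ h => h.symm))

end curve

/-! ### Charts from weighted sums of ramps -/

/-- Weights on the intervals of the long ray before the `α`-th. -/
structure IsWeight (w : Omega1 → ℝ) (α : Omega1) : Prop where
  pos : ∀ β < α, 0 < w β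
  zero : ∀ β, α ≤ β → w β = 0
  hasSum : HasSum w 1

theorem exists_isWeight {α : Omega1} (hα : α ≠ ⊥) : ∃ w, IsWeight w α := by
  obtain ⟨ε, hε, c, hc, -⟩ := (Omega1.countable_Iio α).exists_pos_hasSum_le one_pos
  have hc' : HasSum ((Iio α).indicator ε) c := hasSum_subtype_iff_indicator.1 hc
  have hpos : 0 < c := by
    have h0 : 0 < (Iio α).indicator ε ⊥ := by
      rw [indicator_of_mem (mem_Iio.2 (bot_lt_iff_ne_bot.2 hα))]
      exact hε _
    exact h0.trans_le (le_hasSum hc' ⊥ fun i _ => indicator_nonneg (fun i _ => (hε i).le) i)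
  refine ⟨fun β => c⁻¹ * (Iio α).indicator ε β, fun β hβ => ?_, fun β hβ => ?_, ?_⟩
  · rw [indicator_of_mem (mem_Iio.2 hβ)]
    exact mul_pos (inv_pos.2 hpos) (hε β)
  · rw [indicator_of_notMem (by simpa using hβ), mul_zero]
  · have := hc'.mul_left c⁻¹
    rwa [inv_mul_cancel₀ hpos.ne'] at this

/-- The first coordinate of a chart. -/
noncomputable def proj (w : Omega1 → ℝ) (z : LongPlane) : ℝ :=
  (1 - fade (height z)) * ∑' β, w β * ramp β z + drift z

/-- The domain of a chart. -/
def domain (w : Omega1 → ℝ) : Set LongPlane := {z | proj w z < 1}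

namespace IsWeight
variable {w : Omega1 → ℝ} {α : Omega1} (hw : IsWeight w α)
include hw

theorem nonneg (β : Omega1) : 0 ≤ w β := by
  rcases lt_or_ge β α with h | h
  · exact (hw.pos β h).le
  · exact (hw.zero β h).ge

theorem norm_mul_le {c : ℝ} (hc : c ∈ Icc (0 : ℝ) 1) (β : Omega1) : ‖w β * c‖ ≤ w β := by
  rw [Real.norm_of_nonneg (mul_nonneg (hw.nonneg β) hc.1)]
  exact mul_le_of_le_one_right (hw.nonneg β) hc.2

theorem summable_mul {c : Omega1 → ℝ} (hc : ∀ β, c β ∈ Icc (0 : ℝ) 1) :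
    Summable fun β => w β * c β :=
  Summable.of_norm_bounded hw.hasSum.summable fun β => hw.norm_mul_le (hc β) β

theorem tsum_mul_le_one {c : Omega1 → ℝ} (hc : ∀ β, c β ∈ Icc (0 : ℝ) 1) :
    ∑' β, w β * c β ≤ 1 := by
  rw [← hw.hasSum.tsum_eq]
  exact (hw.summable_mul hc).tsum_le_tsum
    (fun β => mul_le_of_le_one_right (hw.nonneg β) (hc β).2) hw.hasSum.summable

theorem tsum_mul_nonneg {c : Omega1 → ℝ} (hc : ∀ β, c β ∈ Icc (0 : ℝ) 1) :
    0 ≤ ∑' β, w β * c β := tsum_nonneg fun β => mul_nonneg (hw.nonneg β) (hc β).1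

theorem continuous_proj : Continuous (proj w) := by
  refine Continuous.add (Continuous.mul ?_ ?_) continuous_drift
  · exact continuous_const.sub (continuous_fade.comp continuous_height)
  · exact continuous_tsum (fun β => continuous_const.mul (continuous_ramp β)) hw.hasSum.summable
      fun β z => hw.norm_mul_le (ramp_mem_Icc β z) β

theorem isOpen_domain : IsOpen (domain w) := isOpen_Iio.preimage hw.continuous_proj

theorem proj_mono {z z' : LongPlane} (hh : height z = height z') (hr : ∀ β, ramp β z ≤ ramp β z')
    (hd : drift z ≤ drift z') : proj w z ≤ proj w z' := by
  rw [proj, proj, hh]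
  refine add_le_add (mul_le_mul_of_nonneg_left ?_ (sub_nonneg.2 (fade_lt_one _).le)) hd
  exact (hw.summable_mul fun β => ramp_mem_Icc β z).tsum_le_tsum
    (fun β => mul_le_mul_of_nonneg_left (hr β) (hw.nonneg β))
    (hw.summable_mul fun β => ramp_mem_Icc β z')

/-- The ramps are only weakly monotone in `x`; strictness comes from `drift`, whose coefficient
`fade y` is positive off the ray. -/
theorem proj_pt_strictMono {y : ℝ} (hy : y ≠ 0) : StrictMono fun x => proj w (pt x y hy) := by
  intro x x' h
  simp only [proj, height_pt, drift_pt]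
  refine add_lt_add_of_le_of_lt (mul_le_mul_of_nonneg_left ?_ (sub_nonneg.2 (fade_lt_one _).le))
    (mul_lt_mul_of_pos_left (Real.sigmoid_lt h) (fade_pos hy))
  exact (hw.summable_mul fun β => ramp_mem_Icc β _).tsum_le_tsum
    (fun β => mul_le_mul_of_nonneg_left (clamp_mono (by linarith)) (hw.nonneg β))
    (hw.summable_mul fun β => ramp_mem_Icc β _)

/-- The value is a convex combination, with coefficient `fade y > 0`, of a number in `[0, 1]` and a
sigmoid in `(0, 1)`. -/
theorem proj_pt_mem {x y : ℝ} (hy : y ≠ 0) : proj w (pt x y hy) ∈ Ioo (0 : ℝ) 1 := by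
  have h1 := hw.tsum_mul_le_one fun β => ramp_mem_Icc β (pt x y hy)
  have h2 := hw.tsum_mul_nonneg fun β => ramp_mem_Icc β (pt x y hy)
  have h3 := fade_lt_one y
  have h4 := fade_pos hy
  have h5 := Real.sigmoid_pos x
  have h6 := Real.sigmoid_lt_one x
  simp only [proj, height_pt, drift_pt]
  constructor
  · have := mul_nonneg (sub_nonneg.2 h3.le) h2
    have := mul_pos h4 h5
    linarith
  · have := mul_le_mul_of_nonneg_left h1 (sub_nonneg.2 h3.le)
    have := mul_lt_mul_of_pos_left h6 h4
    linarith

omit hw in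
theorem proj_ray (p : OpenLongRay) : proj w (ray p) = ∑' β, w β * p.1.ramp β := by
  simp [proj, fade_zero]

theorem proj_ray_lt {p q : OpenLongRay} (hpq : p < q) (hp : p.1.idx < α) :
    proj w (ray p) < proj w (ray q) := by
  rw [proj_ray, proj_ray]
  refine Summable.tsum_lt_tsum (i := p.1.idx)
    (fun β => mul_le_mul_of_nonneg_left (ClosedLongRay.ramp_mono β hpq.le) (hw.nonneg β))
    (mul_lt_mul_of_pos_left ?_ (hw.pos _ hp))
    (hw.summable_mul fun β => ClosedLongRay.ramp_mem_Icc β _)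
    (hw.summable_mul fun β => ClosedLongRay.ramp_mem_Icc β _)
  rw [ClosedLongRay.ramp_of_idx_eq rfl]
  exact ClosedLongRay.lt_ramp_iff.2 hpq

theorem proj_ray_lt_one_iff {p : OpenLongRay} : proj w (ray p) < 1 ↔ p.1.idx < α := by
  constructor
  · intro h
    by_contra! hc
    refine h.ne ?_
    rw [proj_ray, ← hw.hasSum.tsum_eq]
    refine tsum_congr fun β => ?_
    rcases lt_or_ge β α with hβ | hβ
    · rw [ClosedLongRay.ramp_of_lt_idx (hβ.trans_le hc), mul_one]
    · rw [hw.zero β hβ, zero_mul]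
  · intro h
    rw [proj_ray, ← hw.hasSum.tsum_eq]
    refine Summable.tsum_lt_tsum (i := p.1.idx)
      (fun β => mul_le_of_le_one_right (hw.nonneg β) (ClosedLongRay.ramp_mem_Icc β _).2)
      (mul_lt_of_lt_one_right (hw.pos _ h) ?_)
      (hw.summable_mul fun β => ClosedLongRay.ramp_mem_Icc β _) hw.hasSum.summable
    rw [ClosedLongRay.ramp_of_idx_eq rfl]
    exact p.1.par_lt_one

theorem proj_ray_pos (hα : α ≠ ⊥) (p : OpenLongRay) : 0 < proj w (ray p) := by
  rw [proj_ray]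
  refine (hw.summable_mul fun β => ClosedLongRay.ramp_mem_Icc β _).tsum_pos
    (fun β => mul_nonneg (hw.nonneg β) (ClosedLongRay.ramp_mem_Icc β _).1) ⊥
    (mul_pos (hw.pos ⊥ (bot_lt_iff_ne_bot.2 hα)) ?_)
  have hp := p.2
  rw [ClosedLongRay.isMin_iff, not_and_or] at hp
  by_cases h : p.1.idx = ⊥
  · rw [ClosedLongRay.ramp_of_idx_eq h]
    exact lt_of_le_of_ne p.1.par_nonneg (Ne.symm (hp.resolve_left (not_not.2 h)))
  · rw [ClosedLongRay.ramp_of_lt_idx (bot_lt_iff_ne_bot.2 h)]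
    exact one_pos

theorem proj_mem (hα : α ≠ ⊥) {z : LongPlane} (hz : z ∈ domain w) : proj w z ∈ Ioo (0 : ℝ) 1 := by
  rcases pt_or_ray z with ⟨x, y, hy, rfl⟩ | ⟨p, rfl⟩
  · exact hw.proj_pt_mem hy
  · exact ⟨hw.proj_ray_pos hα p, hz⟩

theorem pt_mem_domain {x y : ℝ} (hy : y ≠ 0) : pt x y hy ∈ domain w := (hw.proj_pt_mem hy).2

theorem injOn : InjOn (fun z => (proj w z, height z)) (domain w) := by
  intro z hz z' hz' h
  obtain ⟨h1, h2⟩ := Prod.ext_iff.1 h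
  rcases pt_or_ray z with ⟨x, y, hy, rfl⟩ | ⟨p, rfl⟩ <;>
  rcases pt_or_ray z' with ⟨x', y', hy', rfl⟩ | ⟨p', rfl⟩
  · simp only [height_pt] at h2
    subst h2
    rw [(hw.proj_pt_strictMono hy).injective h1]
  · exact absurd h2 hy
  · exact absurd h2.symm hy'
  · rcases lt_trichotomy p p' with h | rfl | h
    · exact absurd h1 (hw.proj_ray_lt h (hw.proj_ray_lt_one_iff.1 hz)).ne
    · rfl
    · exact absurd h1 (hw.proj_ray_lt h (hw.proj_ray_lt_one_iff.1 hz')).ne'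

/-- The curve through `(δ, r)` serves as a barrier: by monotonicity of `proj` at fixed height, a
point beyond it has `ramp δ` at least `r`. -/
theorem le_ramp_of_proj_lt {δ : Omega1} {r : ℝ} (h0 : 0 < r) (h1 : r < 1) {z : LongPlane}
    (h : proj w (curve δ r h0 h1 (height z)) < proj w z) : r ≤ ramp δ z := by
  contrapose! h
  rcases pt_or_ray z with ⟨x, y, hy, rfl⟩ | ⟨p, rfl⟩
  · rw [height_pt, curve_of_ne _ _ hy]
    have := lt_of_clamp_lt h h1
    exact (hw.proj_pt_strictMono hy).monotone (by linarith)
  · rw [height_ray, curve_zero]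
    have : p ≤ openMk δ r h0 h1 := by
      by_contra hc
      have := ClosedLongRay.ramp_mono δ (not_le.1 hc).le
      rw [ramp_openMk] at this
      exact h.not_ge this
    exact hw.proj_mono rfl (fun β => ClosedLongRay.ramp_mono β this) (by simp)

theorem ramp_le_of_proj_lt {δ : Omega1} {r : ℝ} (h0 : 0 < r) (h1 : r < 1) {z : LongPlane}
    (h : proj w z < proj w (curve δ r h0 h1 (height z))) : ramp δ z ≤ r := by
  contrapose! h
  rcases pt_or_ray z with ⟨x, y, hy, rfl⟩ | ⟨p, rfl⟩
  · rw [height_pt, curve_of_ne _ _ hy]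
    have := lt_of_lt_clamp h h0
    exact (hw.proj_pt_strictMono hy).monotone (by linarith)
  · rw [height_ray, curve_zero]
    have : openMk δ r h0 h1 ≤ p := by
      by_contra hc
      have := ClosedLongRay.ramp_mono δ (not_le.1 hc).le
      rw [ramp_openMk] at this
      exact h.not_ge this
    exact hw.proj_mono rfl (fun β => ClosedLongRay.ramp_mono β this) (by simp)

theorem eventually_proj_pt_mem (a : ℝ) {y : ℝ} (hy : y ≠ 0) {s : Set ℝ} (hs : IsOpen s)
    (h : proj w (pt a y hy) ∈ s) : ∀ᶠ y' in 𝓝 y, ∀ hy' : y' ≠ 0, proj w (pt a y' hy') ∈ s := by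
  have hc : Continuous fun y' : {y : ℝ // y ≠ 0} => proj w (pt a y' y'.2) :=
    hw.continuous_proj.comp (continuous_pt.comp (Continuous.subtype_mk
      (f := fun y' : {y : ℝ // y ≠ 0} => (a, y'.1)) (by fun_prop) fun p => p.2))
  have h' : ∀ᶠ y' : {y : ℝ // y ≠ 0} in 𝓝 ⟨y, hy⟩, proj w (pt a y' y'.2) ∈ s :=
    hc.continuousAt.preimage_mem_nhds (hs.mem_nhds h)
  rw [nhds_subtype_eq_comap, eventually_comap] at h'
  exact h'.mono fun y' h' hy' => h' ⟨y', hy'⟩ rfl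

theorem tendsto_abscissa {l : Filter LongPlane} {x y : ℝ} (hy : y ≠ 0)
    (h1 : Tendsto (proj w) l (𝓝 (proj w (pt x y hy)))) (h2 : Tendsto height l (𝓝 y)) :
    Tendsto abscissa l (𝓝 x) := by
  have hne : ∀ᶠ z in l, height z ≠ 0 := h2.eventually_ne hy
  refine tendsto_order.2 ⟨fun a ha => ?_, fun a ha => ?_⟩
  · obtain ⟨c, hc1, hc2⟩ := exists_between (hw.proj_pt_strictMono hy ha)
    filter_upwards [hne, h2.eventually (hw.eventually_proj_pt_mem a hy isOpen_Iio hc1),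
      h1.eventually (lt_mem_nhds hc2)] with z hz hz1 hz2
    rcases pt_or_ray z with ⟨x', y', hy', rfl⟩ | ⟨p, rfl⟩
    · exact (hw.proj_pt_strictMono hy').lt_iff_lt.1 ((hz1 hy').trans hz2)
    · exact absurd rfl hz
  · obtain ⟨c, hc1, hc2⟩ := exists_between (hw.proj_pt_strictMono hy ha)
    filter_upwards [hne, h2.eventually (hw.eventually_proj_pt_mem a hy isOpen_Ioi hc2),
      h1.eventually (gt_mem_nhds hc1)] with z hz hz1 hz2
    rcases pt_or_ray z with ⟨x', y', hy', rfl⟩ | ⟨p, rfl⟩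
    · exact (hw.proj_pt_strictMono hy').lt_iff_lt.1 (lt_trans hz2 (hz1 hy'))
    · exact absurd rfl hz

/-- Continuity of the inverse chart. Off the ray the abscissa is recovered by strict monotonicity;
at a ray point each ramp, including those of weight zero, is squeezed between barrier curves. -/
theorem tendsto_of_tendsto_proj {l : Filter LongPlane} {z₀ : LongPlane} (hz₀ : z₀ ∈ domain w)
    (h1 : Tendsto (proj w) l (𝓝 (proj w z₀))) (h2 : Tendsto height l (𝓝 (height z₀))) :
    Tendsto id l (𝓝 z₀) := by
  refine tendsto_nhds_iff.2 ⟨h2, ?_⟩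
  rcases pt_or_ray z₀ with ⟨x, y, hy, rfl⟩ | ⟨p, rfl⟩
  · have ha := hw.tendsto_abscissa hy h1 h2
    refine ⟨((continuous_fade.tendsto _).comp h2).mul
      ((_root_.continuous_sigmoid.tendsto _).comp ha), fun β => ?_⟩
    have : Tendsto (fun z => clamp (abscissa z - tower β (height z))) l
        (𝓝 (clamp (x - tower β y))) :=
      (continuous_clamp.tendsto _).comp (ha.sub ((continuousAt_tower β hy).tendsto.comp h2))
    refine this.congr' ((h2.eventually_ne hy).mono fun z hz => ?_)
    rcases pt_or_ray z with ⟨x', y', hy', rfl⟩ | ⟨p, rfl⟩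
    · rfl
    · exact absurd rfl hz
  · refine ⟨by simpa using tendsto_drift_zero h2, fun δ => ?_⟩
    have hp := hw.proj_ray_lt_one_iff.1 hz₀
    have hI := ClosedLongRay.ramp_mem_Icc δ p.1
    have hcurve : ∀ r (h0 : 0 < r) (hr : r < 1), Tendsto
        (fun z => proj w (curve δ r h0 hr (height z))) l (𝓝 (proj w (ray (openMk δ r h0 hr)))) := by
      intro r h0 hr
      have := hw.continuous_proj.continuousAt.comp (continuousAt_curve (δ := δ) h0 hr)
      rw [← curve_zero]
      exact this.tendsto.comp h2
    refine tendsto_order.2 ⟨fun a ha => ?_, fun a ha => ?_⟩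
    · rcases lt_or_ge a 0 with ha0 | ha0
      · exact Eventually.of_forall fun z => ha0.trans_le (ramp_mem_Icc δ z).1
      obtain ⟨r, hr1, hr2⟩ := exists_between ha
      have h0 : 0 < r := ha0.trans_lt hr1
      have hr : r < 1 := hr2.trans_le hI.2
      have hlt : openMk δ r h0 hr < p := ClosedLongRay.lt_ramp_iff.1 hr2
      have hidx : (openMk δ r h0 hr).1.idx < α := by
        rcases ClosedLongRay.lt_iff.1 hlt with h | h
        · exact h.trans hp
        · exact h.1.trans_lt hp
      filter_upwards [(hcurve r h0 hr).eventually_lt h1 (hw.proj_ray_lt hlt hidx)] with z hz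
      exact hr1.trans_le (hw.le_ramp_of_proj_lt h0 hr hz)
    · rcases lt_or_ge 1 a with ha1 | ha1
      · exact Eventually.of_forall fun z => (ramp_mem_Icc δ z).2.trans_lt ha1
      obtain ⟨r, hr1, hr2⟩ := exists_between ha
      have h0 : 0 < r := hI.1.trans_lt hr1
      have hr : r < 1 := hr2.trans_le ha1
      have hlt : p < openMk δ r h0 hr := by
        by_contra hc
        have := ClosedLongRay.ramp_mono δ (not_lt.1 hc)
        rw [ramp_openMk] at this
        exact hr1.not_ge this
      filter_upwards [h1.eventually_lt (hcurve r h0 hr) (hw.proj_ray_lt hlt hp)] with z hz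
      exact (hw.ramp_le_of_proj_lt h0 hr hz).trans_lt hr2

theorem isEmbedding : IsEmbedding fun z : domain w => (proj w z.1, height z.1) := by
  refine ⟨isInducing_iff_nhds.2 fun z => le_antisymm ?_ ?_, hw.injOn.injective⟩
  · exact ((hw.continuous_proj.prodMk continuous_height).comp
      continuous_subtype_val).continuousAt.tendsto.le_comap
  · rw [nhds_subtype_eq_comap, ← tendsto_iff_comap]
    set l := comap (fun z : domain w => (proj w z.1, height z.1)) (𝓝 (proj w z.1, height z.1))
    have h : Tendsto (fun z : domain w => (proj w z.1, height z.1)) l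
      (𝓝 (proj w z.1, height z.1)) := tendsto_comap
    rw [nhds_prod_eq, tendsto_prod_iff'] at h
    exact hw.tendsto_of_tendsto_proj (l := map Subtype.val l) z.2 h.1 h.2

theorem tendsto_proj_pt_atTop {y : ℝ} (hy : y ≠ 0) :
    Tendsto (fun x => proj w (pt x y hy)) atTop (𝓝 1) := by
  have h : Tendsto (fun x => ∑' β, w β * clamp (x - tower β y)) atTop (𝓝 (∑' β, w β * 1)) := by
    refine tendsto_tsum_of_dominated_convergence hw.hasSum.summable (fun β => ?_)
      (Eventually.of_forall fun x β => hw.norm_mul_le (clamp_mem_Icc _) β)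
    refine tendsto_const_nhds.mul (tendsto_const_nhds.congr' ?_)
    filter_upwards [eventually_ge_atTop (tower β y + 1)] with x hx
    rw [clamp_of_one_le (by linarith)]
  have := (h.const_mul (1 - fade y)).add (Real.tendsto_sigmoid_atTop.const_mul (fade y))
  rw [tsum_mul_right, hw.hasSum.tsum_eq, mul_one, mul_one, mul_one, sub_add_cancel] at this
  exact this

theorem tendsto_proj_pt_atBot {y : ℝ} (hy : y ≠ 0) :
    Tendsto (fun x => proj w (pt x y hy)) atBot (𝓝 0) := by
  have h : Tendsto (fun x => ∑' β, w β * clamp (x - tower β y)) atBot (𝓝 (∑' β, w β * 0)) := by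
    refine tendsto_tsum_of_dominated_convergence hw.hasSum.summable (fun β => ?_)
      (Eventually.of_forall fun x β => hw.norm_mul_le (clamp_mem_Icc _) β)
    refine tendsto_const_nhds.mul (tendsto_const_nhds.congr' ?_)
    filter_upwards [eventually_le_atBot (tower β y)] with x hx
    rw [clamp_of_nonpos (by linarith)]
  have := (h.const_mul (1 - fade y)).add (Real.tendsto_sigmoid_atBot.const_mul (fade y))
  simp only [mul_zero, tsum_zero, add_zero] at this
  exact this

theorem exists_proj_pt_eq {y : ℝ} (hy : y ≠ 0) {v : ℝ} (hv : v ∈ Ioo (0 : ℝ) 1) :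
    ∃ x, proj w (pt x y hy) = v :=
  mem_range_of_exists_le_of_exists_ge (hw.continuous_proj.comp (isEmbedding_pt hy).continuous)
    (((hw.tendsto_proj_pt_atBot hy).eventually (gt_mem_nhds hv.1)).exists.imp fun _ h => h.le)
    (((hw.tendsto_proj_pt_atTop hy).eventually (lt_mem_nhds hv.2)).exists.imp fun _ h => h.le)

theorem hasSum_interval (β : Omega1) {s : ℝ} :
    HasSum (fun γ => (Iio β).indicator w γ + if γ = β then w β * s else 0)
      (∑' γ, (Iio β).indicator w γ + w β * s) :=
  (hw.hasSum.summable.indicator _).hasSum.add (hasSum_ite_eq β _)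

theorem tsum_mul_ramp (p : ClosedLongRay) :
    ∑' γ, w γ * p.ramp γ = ∑' γ, (Iio p.idx).indicator w γ + w p.idx * p.par := by
  rw [← (hw.hasSum_interval p.idx).tsum_eq]
  refine tsum_congr fun γ => ?_
  rcases lt_trichotomy γ p.idx with h | h | h
  · rw [ClosedLongRay.ramp_of_lt_idx h, indicator_of_mem (mem_Iio.2 h), if_neg h.ne]; simp
  · rw [ClosedLongRay.ramp_of_idx_eq h.symm, h]; simp
  · rw [ClosedLongRay.ramp_of_idx_lt h, indicator_of_notMem (by simpa using h.le), if_neg h.ne']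
    simp

theorem sum_le_interval {β : Omega1} {s : Finset Omega1} (hs : ∀ γ ∈ s, γ ≤ β) :
    ∑ γ ∈ s, w γ ≤ ∑' γ, (Iio β).indicator w γ + w β := by
  have h := hw.hasSum_interval β (s := 1)
  rw [mul_one] at h
  refine le_trans (Finset.sum_le_sum fun γ hγ => ?_) (sum_le_hasSum s (fun γ _ => ?_) h)
  · rcases (hs γ hγ).lt_or_eq with h' | h'
    · rw [indicator_of_mem (mem_Iio.2 h'), if_neg h'.ne, add_zero]
    · simp [h']
  · exact add_nonneg (indicator_nonneg (fun γ _ => hw.nonneg γ) γ)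
      (by split_ifs <;> simp [hw.nonneg])

/-- A number below the total weight lies in the interval of one of the weights. -/
theorem exists_interval {v : ℝ} (hv : v ∈ Ioo (0 : ℝ) 1) :
    ∃ β, ∑' γ, (Iio β).indicator w γ ≤ v ∧ v < ∑' γ, (Iio β).indicator w γ + w β := by
  have key : ∀ {f : Omega1 → ℝ} {c : ℝ}, HasSum f c → v < c → ∃ s : Finset Omega1, s.Nonempty ∧
      v < ∑ γ ∈ s, f γ := by
    intro f c hf hc
    obtain ⟨s, hs⟩ := (hf.eventually (lt_mem_nhds hc)).exists
    refine ⟨s, Finset.nonempty_iff_ne_empty.2 fun h => ?_, hs⟩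
    rw [h, Finset.sum_empty] at hs
    exact hs.not_gt hv.1
  have hne : {β | v < ∑' γ, (Iio β).indicator w γ + w β}.Nonempty := by
    obtain ⟨s, hs, h⟩ := key hw.hasSum hv.2
    exact ⟨s.max' hs, h.trans_le (hw.sum_le_interval fun γ hγ => s.le_max' γ hγ)⟩
  -- Take the first `β` whose interval ends beyond `v`. If it also began beyond `v`, a finite sum of
  -- earlier weights would exceed `v`, and the largest index in it would contradict minimality.
  obtain ⟨β, hβ, hmin⟩ := wellFounded_lt.has_min _ hne
  refine ⟨β, ?_, hβ⟩
  by_contra! hc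
  obtain ⟨s, -, h⟩ := key (hw.hasSum.summable.indicator (Iio β)).hasSum hc
  classical
  have hsum : ∑ γ ∈ s, (Iio β).indicator w γ = ∑ γ ∈ s with γ < β, w γ := by
    rw [Finset.sum_filter]
    exact Finset.sum_congr rfl fun γ _ => by simp [indicator_apply]
  rw [hsum] at h
  have hs : (s.filter (· < β)).Nonempty := Finset.nonempty_iff_ne_empty.2 fun h' => by
    rw [h', Finset.sum_empty] at h
    exact h.not_gt hv.1
  exact hmin _ (h.trans_le (hw.sum_le_interval fun γ hγ => Finset.le_max' _ γ hγ))
    (Finset.mem_filter.1 (Finset.max'_mem _ hs)).2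

theorem exists_proj_ray_eq {v : ℝ} (hv : v ∈ Ioo (0 : ℝ) 1) : ∃ p, proj w (ray p) = v := by
  obtain ⟨β, h1, h2⟩ := hw.exists_interval hv
  have hβ : 0 < w β := by linarith
  set s := (v - ∑' γ, (Iio β).indicator w γ) / w β
  have hs : w β * s = v - ∑' γ, (Iio β).indicator w γ := mul_div_cancel₀ _ hβ.ne'
  set p := ClosedLongRay.mk β s (div_nonneg (by linarith) hβ.le)
    ((div_lt_one hβ).2 (by linarith))
  have hp : ∑' γ, w γ * p.ramp γ = v := by
    rw [hw.tsum_mul_ramp]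
    change ∑' γ, (Iio β).indicator w γ + w β * s = v
    linarith
  refine ⟨⟨p, fun hmin => hv.1.ne ?_⟩, by rw [proj_ray]; exact hp⟩
  rw [ClosedLongRay.isMin_iff] at hmin
  rw [← hp, hw.tsum_mul_ramp, hmin.1, hmin.2]
  simp

theorem range_eq (hα : α ≠ ⊥) :
    range (fun z : domain w => (proj w z.1, height z.1)) = Ioo 0 1 ×ˢ univ := by
  ext ⟨v, y⟩
  constructor
  · rintro ⟨z, hz⟩
    rw [← hz]
    exact ⟨hw.proj_mem hα z.2, trivial⟩
  · rintro ⟨hv, -⟩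
    rcases eq_or_ne y 0 with rfl | hy
    · obtain ⟨p, hp⟩ := hw.exists_proj_ray_eq hv
      exact ⟨⟨ray p, hp.trans_lt hv.2⟩, by simp [hp]⟩
    · obtain ⟨x, hx⟩ := hw.exists_proj_pt_eq hy hv
      exact ⟨⟨pt x y hy, hw.pt_mem_domain hy⟩, by simp [hx]⟩

/-- The domains are planes, foliated by the levels of the second coordinate. -/
theorem exists_homeomorph (hα : α ≠ ⊥) :
    ∃ h : domain w ≃ₜ ℝ × ℝ, ∀ z, (h z).2 = height z.1 := by
  -- The sigmoid stretches the image strip `(0, 1) × ℝ` to the plane without changing the height.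
  have hk : IsEmbedding (Prod.map Real.sigmoid id : ℝ × ℝ → ℝ × ℝ) :=
    (Real.sigmoid_strictMono.isEmbedding_of_ordConnected
      (by rw [Real.range_sigmoid]; exact ordConnected_Ioo)).prodMap IsEmbedding.id
  have hr : range (fun z : domain w => (proj w z.1, height z.1)) =
      range (Prod.map Real.sigmoid id : ℝ × ℝ → ℝ × ℝ) := by
    rw [hw.range_eq hα, range_prodMap, Real.range_sigmoid, range_id]
  refine ⟨(hw.isEmbedding.toHomeomorph.trans (Homeomorph.setCongr hr)).trans
    hk.toHomeomorph.symm, fun z => ?_⟩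
  have h : (hk.toHomeomorph (hk.toHomeomorph.symm
      (Homeomorph.setCongr hr (hw.isEmbedding.toHomeomorph z)))).1 = (proj w z.1, height z.1) := by
    rw [Homeomorph.apply_symm_apply]; rfl
  exact congrArg Prod.snd h

end IsWeight
end LongPlane

/-- Within one level, the leaf topology and the surface topology induce the same topology. -/
theorem Foliation.leafHomeomorphic_range {M X : Type*} [TopologicalSpace M] [TopologicalSpace X]
    {F : Foliation M} {y : M → ℝ} (hF : F.leafTopology = levelTopology y) {f : X → M}
    (hf : IsEmbedding f) {c : ℝ} (hc : ∀ x, y (f x) = c) : F.LeafHomeomorphic (range f) X := by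
  have h : TopologicalSpace.induced (Subtype.val : range f → M) F.leafTopology =
      (inferInstance : TopologicalSpace (range f)) := by
    rw [hF]
    exact induced_levelTopology_of_subset_level (c := c) (by rintro _ ⟨x, rfl⟩; exact hc x)
  rw [Foliation.LeafHomeomorphic, h]
  exact ⟨hf.toHomeomorph.symm⟩

/-! ### The long plane as a surface -/

namespace LongPlane

theorem eventually_mem_domain (z : LongPlane) :
    ∀ᶠ α in atTop, ∀ w, IsWeight w α → z ∈ domain w := by
  rcases pt_or_ray z with ⟨x, y, hy, rfl⟩ | ⟨p, rfl⟩
  · exact Eventually.of_forall fun α w hw => hw.pt_mem_domain hy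
  · exact (eventually_gt_atTop p.1.idx).mono fun α hα w hw => hw.proj_ray_lt_one_iff.2 hα

theorem exists_weight_mem_domain (z z' : LongPlane) :
    ∃ α w, α ≠ ⊥ ∧ IsWeight w α ∧ z ∈ domain w ∧ z' ∈ domain w := by
  obtain ⟨α, h1, h2, h3⟩ := ((eventually_mem_domain z).and
    ((eventually_mem_domain z').and (eventually_gt_atTop ⊥))).exists
  obtain ⟨w, hw⟩ := exists_isWeight h3.ne'
  exact ⟨α, w, h3.ne', hw, h1 w hw, h2 w hw⟩

instance : T2Space LongPlane := by
  refine ⟨fun z z' hne => ?_⟩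
  obtain ⟨α, w, -, hw, hz, hz'⟩ := exists_weight_mem_domain z z'
  exact separated_by_continuous (hw.continuous_proj.prodMk continuous_height)
    fun h => hne (hw.injOn hz hz' h)

theorem exists_chart (z : LongPlane) : ∃ φ ∈ levelAtlas height, z ∈ φ.source := by
  obtain ⟨α, w, hα, hw, hz, -⟩ := exists_weight_mem_domain z z
  obtain ⟨h, hh⟩ := hw.exists_homeomorph hα
  let U : TopologicalSpace.Opens LongPlane := ⟨domain w, hw.isOpen_domain⟩
  have hU : Nonempty U := ⟨⟨z, hz⟩⟩
  let φ : OpenPartialHomeomorph LongPlane (ℝ × ℝ) :=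
    (U.openPartialHomeomorphSubtypeCoe hU).symm.trans h.toOpenPartialHomeomorph
  have hs : φ.source = domain w := by simp [φ, U]
  refine ⟨φ, fun z' hz' => ?_, hs ▸ hz⟩
  rw [hs] at hz'
  have e : (U.openPartialHomeomorphSubtypeCoe hU).symm z' = ⟨z', hz'⟩ :=
    (U.openPartialHomeomorphSubtypeCoe hU).left_inv (x := ⟨z', hz'⟩) (by simp)
  change (h ((U.openPartialHomeomorphSubtypeCoe hU).symm z')).2 = _
  rw [e, hh]

/-- Move vertically in a chart: heights different from 0 are dense on the vertical line through the
point. -/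
theorem exists_mem_height_ne_zero {z : LongPlane} {U : Set LongPlane} (hU : U ∈ 𝓝 z) :
    ∃ z' ∈ U, height z' ≠ 0 := by
  obtain ⟨α, w, hα, hw, hz, -⟩ := exists_weight_mem_domain z z
  obtain ⟨h, hh⟩ := hw.exists_homeomorph hα
  have hf : Continuous fun y => (h.symm ((h ⟨z, hz⟩).1, y)).1 := by fun_prop
  have hfz : (h.symm ((h ⟨z, hz⟩).1, height z)).1 = z := by
    rw [← hh ⟨z, hz⟩, Prod.mk.eta, Homeomorph.symm_apply_apply]
  obtain ⟨y, hy, hyU⟩ := (dense_compl_singleton (0 : ℝ)).inter_nhds_nonempty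
    (hf.continuousAt.preimage_mem_nhds (x := height z) (by rw [hfz]; exact hU))
  refine ⟨_, hyU, ?_⟩
  rw [← hh, Homeomorph.apply_symm_apply]
  exact hy

/-! ### Puncturing, and the decomposition into `O` and `L` -/

/-- The point that is removed from the long plane. -/
def hole : LongPlane := pt 0 1 one_ne_zero

/-- The long plane with a point removed. -/
def punctured : TopologicalSpace.Opens LongPlane := ⟨{hole}ᶜ, isOpen_compl_singleton⟩

theorem exists_chart_punctured (z : punctured) :
    ∃ φ ∈ levelAtlas (fun z : punctured => height z.1), z ∈ φ.source := by
  obtain ⟨φ, hφ, hz⟩ := exists_chart z.1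
  refine ⟨φ.subtypeRestr ⟨z⟩, fun z' hz' => ?_, ?_⟩
  · rw [OpenPartialHomeomorph.subtypeRestr_source] at hz'
    rw [OpenPartialHomeomorph.subtypeRestr_coe]
    exact hφ _ hz'
  · rw [OpenPartialHomeomorph.subtypeRestr_source]
    exact hz

theorem punctured_exists_mem_height_ne_zero {z : punctured} {U : Set punctured} (hU : U ∈ 𝓝 z) :
    ∃ z' ∈ U, height z'.1 ≠ 0 := by
  obtain ⟨z', ⟨z'', hz'', rfl⟩, h⟩ := exists_mem_height_ne_zero
    (punctured.isOpen.isOpenMap_subtype_val.image_mem_nhds hU)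
  exact ⟨z'', hz'', h⟩

theorem ray_mem_punctured (p : OpenLongRay) : ray p ∈ punctured := fun h =>
  one_ne_zero (congrArg height h).symm

/-- The long ray inside the punctured long plane. -/
def puncturedRay (p : OpenLongRay) : punctured := ⟨ray p, ray_mem_punctured p⟩

theorem isEmbedding_puncturedRay : IsEmbedding puncturedRay :=
  isEmbedding_ray.codRestrict _ ray_mem_punctured

section planePart
variable {w : Omega1 → ℝ} (hw : IsWeight w (Order.succ ⊥))
include hw

theorem puncturedRay_mem_domain_iff {p : OpenLongRay} :
    (puncturedRay p).1 ∈ domain w ↔ p.1.idx = ⊥ := by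
  refine hw.proj_ray_lt_one_iff.trans ?_
  rw [Order.lt_succ_iff, le_bot_iff]

theorem exists_homeomorph_planePart :
    Nonempty ((Subtype.val ⁻¹' domain w : Set punctured) ≃ₜ {p : ℝ × ℝ // p ≠ (0, 0)}) := by
  obtain ⟨h, -⟩ := hw.exists_homeomorph (Order.bot_lt_succ ⊥).ne'
  have hq : hole ∈ domain w := hw.pt_mem_domain _
  let e : domain w ≃ₜ ℝ × ℝ := h.trans (Homeomorph.subRight (h ⟨hole, hq⟩))
  -- The translation in `e` places the hole at the origin.
  have he : ∀ z : domain w, z.1 ≠ hole ↔ e z ≠ (0, 0) := by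
    intro z
    have : e z = h z - h ⟨hole, hq⟩ := rfl
    rw [this, ← Prod.zero_eq_mk, Ne, Ne, sub_eq_zero, h.injective.eq_iff, Subtype.ext_iff]
  let r : (Subtype.val ⁻¹' domain w : Set punctured) ≃ₜ {z : domain w // z.1 ≠ hole} :=
    { toFun := fun z => ⟨⟨z.1.1, z.2⟩, z.1.2⟩
      invFun := fun z => ⟨⟨z.1.1, z.2⟩, z.1.2⟩
      left_inv := fun _ => rfl
      right_inv := fun _ => rfl
      continuous_toFun := by fun_prop
      continuous_invFun := by fun_prop }
  exact ⟨r.trans (e.subtype he)⟩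

theorem exists_homeomorph_compl_planePart :
    Nonempty (((Subtype.val ⁻¹' domain w)ᶜ : Set punctured) ≃ₜ ClosedLongRay) := by
  obtain ⟨J, hJ, hr⟩ := ClosedLongRay.exists_isEmbedding_range
  have hJ' : ∀ c, (J c).idx ≠ ⊥ := fun c => by
    have : J c ∈ range J := ⟨c, rfl⟩
    rwa [hr] at this
  have hmin : ∀ c, ¬ IsMin (J c) := fun c hc => hJ' c (ClosedLongRay.isMin_iff.1 hc).1
  have hκ : IsEmbedding fun c => puncturedRay ⟨J c, hmin c⟩ :=
    isEmbedding_puncturedRay.comp (hJ.codRestrict {x | ¬ IsMin x} hmin)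
  have hrange : range (fun c => puncturedRay ⟨J c, hmin c⟩) =
      ((Subtype.val ⁻¹' domain w)ᶜ : Set punctured) := by
    ext z
    constructor
    · rintro ⟨c, rfl⟩ hc
      exact hJ' c ((puncturedRay_mem_domain_iff hw).1 hc)
    · intro hz
      obtain ⟨z, hz0⟩ := z
      rcases pt_or_ray z with ⟨x, y, hy, rfl⟩ | ⟨p, rfl⟩
      · exact absurd (hw.pt_mem_domain hy) hz
      · have : p.1 ∈ range J := by
          rw [hr]
          exact fun h => hz ((puncturedRay_mem_domain_iff hw).2 h)
        obtain ⟨c, hc⟩ := this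
        exact ⟨c, Subtype.ext (congrArg ray (Subtype.ext hc))⟩
  exact ⟨(hκ.toHomeomorph.trans (Homeomorph.setCongr hrange)).symm⟩

theorem dense_planePart : Dense (Subtype.val ⁻¹' domain w : Set punctured) := by
  intro z
  rw [mem_closure_iff_nhds]
  intro U hU
  obtain ⟨⟨z', hz0⟩, hz', h⟩ := punctured_exists_mem_height_ne_zero hU
  refine ⟨_, hz', ?_⟩
  rcases pt_or_ray z' with ⟨x, y, hy, rfl⟩ | ⟨p, rfl⟩
  · exact hw.pt_mem_domain hy
  · exact absurd rfl h

/-- A punctured plane is connected, and the space is the closure of one. -/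
theorem connectedSpace_punctured : ConnectedSpace punctured := by
  obtain ⟨e⟩ := exists_homeomorph_planePart hw
  have h1 : IsConnected ({(0, 0)}ᶜ : Set (ℝ × ℝ)) :=
    isConnected_compl_singleton_of_one_lt_rank (by
      rw [← Module.finrank_eq_rank, Module.finrank_prod, Module.finrank_self]
      norm_num) _
  have h2 : ConnectedSpace {p : ℝ × ℝ // p ≠ (0, 0)} := isConnected_iff_connectedSpace.1 h1
  have h3 : ConnectedSpace (Subtype.val ⁻¹' domain w : Set punctured) :=
    e.symm.surjective.connectedSpace e.symm.continuous
  have h4 := (isConnected_iff_connectedSpace.2 h3).closure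
  rw [(dense_planePart hw).closure_eq] at h4
  exact connectedSpace_iff_univ.2 h4

theorem separableSpace_punctured : TopologicalSpace.SeparableSpace punctured := by
  obtain ⟨e⟩ := exists_homeomorph_planePart hw
  have h1 : TopologicalSpace.SeparableSpace (Subtype.val ⁻¹' domain w : Set punctured) :=
    e.symm.surjective.denseRange.separableSpace e.symm.continuous
  have h2 := (TopologicalSpace.IsSeparable.of_subtype
    (Subtype.val ⁻¹' domain w : Set punctured)).closure
  rw [(dense_planePart hw).closure_eq] at h2
  exact TopologicalSpace.isSeparable_univ_iff.1 h2

end planePart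

/-! ### The leaves of the punctured long plane -/

/-- A function whose fibres are the leaves of the punctured long plane. -/
def label (z : punctured) : ℝ × Prop := (height z.1, height z.1 = 1 ∧ 0 < abscissa z.1)

theorem label_eq_iff {z z' : punctured} : label z = label z' ↔
    height z.1 = height z'.1 ∧ (height z'.1 = 1 → (0 < abscissa z.1 ↔ 0 < abscissa z'.1)) := by
  simp only [label, Prod.mk.injEq, eq_iff_iff]
  refine and_congr_right fun h => ?_
  rw [h]
  tauto

theorem pt_mem_punctured {x y : ℝ} (hy : y ≠ 0) (h : y = 1 → x ≠ 0) : pt x y hy ∈ punctured :=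
  fun e => h (congrArg height e) (congrArg abscissa e)

theorem abscissa_ne_zero (z : punctured) (h : height z.1 = 1) : abscissa z.1 ≠ 0 := by
  obtain ⟨z, hz⟩ := z
  rcases pt_or_ray z with ⟨x, y, hy, rfl⟩ | ⟨p, rfl⟩
  · simp only [height_pt] at h
    subst h
    intro hx
    simp only [abscissa_pt] at hx
    subst hx
    exact hz rfl
  · exact absurd h.symm one_ne_zero

theorem label_locally_constant (z : punctured) :
    ∃ V, IsOpen V ∧ z ∈ V ∧ ∀ z' ∈ V, height z'.1 = height z.1 → label z' = label z := by
  by_cases h : height z.1 = 1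
  -- At height 1 the sign of the abscissa is read off from the continuous function `drift`, compared
  -- with its value at the hole; `abscissa` itself jumps to a default value on the ray.
  · have hd : ∀ z' : punctured, height z'.1 = 1 →
        (fade 1 * Real.sigmoid 0 < drift z'.1 ↔ 0 < abscissa z'.1) := by
      intro z' hz'
      rw [drift, hz', mul_lt_mul_iff_right₀ (fade_pos one_ne_zero), Real.sigmoid_lt_iff]
    have hd' : ∀ z' : punctured, height z'.1 = 1 →
        (drift z'.1 < fade 1 * Real.sigmoid 0 ↔ abscissa z'.1 < 0) := by
      intro z' hz'
      rw [drift, hz', mul_lt_mul_iff_right₀ (fade_pos one_ne_zero), Real.sigmoid_lt_iff]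
    have hc : Continuous fun z : punctured => drift z.1 :=
      continuous_drift.comp continuous_subtype_val
    rcases (abscissa_ne_zero z h).lt_or_gt with ha | ha
    · refine ⟨_, isOpen_Iio.preimage hc, (hd' z h).2 ha, fun z' hz' hh => ?_⟩
      have := (hd' z' (hh.trans h)).1 hz'
      exact label_eq_iff.2 ⟨hh, fun _ => iff_of_false (not_lt.2 this.le) (not_lt.2 ha.le)⟩
    · refine ⟨_, isOpen_Ioi.preimage hc, (hd z h).2 ha, fun z' hz' hh => ?_⟩
      have := (hd z' (hh.trans h)).1 hz'
      exact label_eq_iff.2 ⟨hh, fun _ => by simp [ha, this]⟩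
  · exact ⟨univ, isOpen_univ, trivial, fun z' _ hh => label_eq_iff.2 ⟨hh, fun h' => absurd h' h⟩⟩

theorem range_puncturedRay (p : OpenLongRay) :
    range puncturedRay = label ⁻¹' {label (puncturedRay p)} := by
  ext z
  rw [mem_preimage, mem_singleton_iff, label_eq_iff]
  constructor
  · rintro ⟨q, rfl⟩
    exact ⟨rfl, fun h => absurd h.symm one_ne_zero⟩
  · rintro ⟨h, -⟩
    obtain ⟨z, hz⟩ := z
    rcases pt_or_ray z with ⟨x, y, hy, rfl⟩ | ⟨q, rfl⟩
    · exact absurd h hy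
    · exact ⟨q, rfl⟩

theorem range_puncturedRay_eq_preimage_label {z : punctured} (hz : height z.1 = 0) :
    range puncturedRay = label ⁻¹' {label z} := by
  obtain ⟨z, hz0⟩ := z
  rcases pt_or_ray z with ⟨x, y, hy, rfl⟩ | ⟨p, rfl⟩
  · exact absurd hz hy
  · exact range_puncturedRay p

theorem exists_isEmbedding_range_eq_preimage_label {z : punctured} (hz : height z.1 ≠ 0) :
    ∃ f : ℝ → punctured, IsEmbedding f ∧ range f = label ⁻¹' {label z} := by
  set y := height z.1
  -- Here `θ` parametrizes the abscissas of the leaf: `-exp` and `exp` for the two halves of level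
  -- 1, the identity for the other nonzero levels.
  have key : ∀ θ : ℝ → ℝ, IsEmbedding θ → (∀ z' : punctured, label z' = label z ↔
      height z'.1 = y ∧ abscissa z'.1 ∈ range θ) → (y = 1 → ∀ t, θ t ≠ 0) →
      ∃ f : ℝ → punctured, IsEmbedding f ∧ range f = label ⁻¹' {label z} := by
    intro θ hθ hl h0
    have hm : ∀ t, pt (θ t) y hz ∈ punctured := fun t => pt_mem_punctured hz fun h => h0 h t
    refine ⟨fun t => ⟨pt (θ t) y hz, hm t⟩,
      ((isEmbedding_pt hz).comp hθ).codRestrict _ hm, ?_⟩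
    ext z'
    rw [mem_preimage, mem_singleton_iff, hl]
    constructor
    · rintro ⟨t, rfl⟩
      exact ⟨rfl, t, rfl⟩
    · rintro ⟨h1, t, ht⟩
      refine ⟨t, Subtype.ext ?_⟩
      obtain ⟨z', hz'⟩ := z'
      rcases pt_or_ray z' with ⟨x', y', hy', rfl⟩ | ⟨q, rfl⟩
      · simp only [height_pt, abscissa_pt] at h1 ht
        subst h1
        subst ht
        rfl
      · exact absurd h1.symm hz
  have hexp : IsEmbedding Real.exp := Real.exp_strictMono.isEmbedding_of_ordConnected
    (by rw [Real.range_exp]; exact ordConnected_Ioi)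
  by_cases h : y = 1
  · rcases (abscissa_ne_zero z h).lt_or_gt with ha | ha
    · refine key (fun t => -Real.exp t) ((Homeomorph.neg ℝ).isEmbedding.comp hexp)
        (fun z' => ?_) fun _ t => neg_ne_zero.2 (Real.exp_pos t).ne'
      have hr : range (fun t => -Real.exp t) = Iio 0 := by
        have : (fun t => -Real.exp t) = Neg.neg ∘ Real.exp := rfl
        rw [this, range_comp, Real.range_exp, image_neg_Ioi, neg_zero]
      rw [label_eq_iff, hr]
      refine and_congr_right fun hh => ⟨fun h' => ?_, fun h' _ => ?_⟩
      · exact (abscissa_ne_zero z' (hh.trans h)).lt_of_le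
          (not_lt.1 fun hc => ha.not_gt (((h' h).1 hc)))
      · exact iff_of_false (not_lt.2 (le_of_lt h')) ha.not_gt
    · refine key Real.exp hexp (fun z' => ?_) fun _ t => (Real.exp_pos t).ne'
      rw [label_eq_iff, Real.range_exp]
      exact and_congr_right fun hh => ⟨fun h' => (h' h).2 ha, fun h' _ => iff_of_true h' ha⟩
  · refine key id IsEmbedding.id (fun z' => ?_) fun h' => absurd h' h
    rw [label_eq_iff, range_id]
    exact and_congr_right fun hh => ⟨fun _ => trivial, fun _ h' => absurd h' h⟩

theorem isPathConnected_range_puncturedRay : IsPathConnected (range puncturedRay) := by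
  refine isPathConnected_iff.2 ⟨⟨_, openMk ⊥ (1 / 2) (by norm_num) (by norm_num), rfl⟩, ?_⟩
  rintro _ ⟨p, rfl⟩ _ ⟨q, rfl⟩
  -- Two points of the ray lie in a common chart, whose level 0 is an ordinary line `f` joining
  -- them.
  obtain ⟨α, w, hα, hw, hp, hq⟩ := exists_weight_mem_domain (ray p) (ray q)
  obtain ⟨h, hh⟩ := hw.exists_homeomorph hα
  have h0 : ∀ t, height (h.symm (t, 0)).1 = 0 := fun t => by
    rw [← hh, Homeomorph.apply_symm_apply]
  have hm : ∀ t, (h.symm (t, 0)).1 ∈ punctured := fun t ht =>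
    one_ne_zero ((congrArg height ht).symm.trans (h0 t))
  let f : ℝ → punctured := fun t => ⟨(h.symm (t, 0)).1, hm t⟩
  have hf : Continuous f := by fun_prop
  have hfr : ∀ r (hr : ray r ∈ domain w), puncturedRay r ∈ range f := by
    intro r hr
    refine ⟨(h ⟨ray r, hr⟩).1, Subtype.ext ?_⟩
    have : ((h ⟨ray r, hr⟩).1, (0 : ℝ)) = h ⟨ray r, hr⟩ := 
      Prod.ext rfl ((height_ray r).symm.trans (hh ⟨ray r, hr⟩).symm)
    change (h.symm ((h ⟨ray r, hr⟩).1, 0)).1 = ray r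
    rw [this, Homeomorph.symm_apply_apply]
  refine ((isPathConnected_range hf).joinedIn _ (hfr p hp) _ (hfr q hq)).mono ?_
  rw [range_puncturedRay p]
  rintro _ ⟨t, rfl⟩
  exact label_eq_iff.2 ⟨h0 t, fun h => absurd h.symm one_ne_zero⟩

theorem isPathConnected_preimage_label (z : punctured) :
    IsPathConnected (label ⁻¹' {label z}) := by
  by_cases hz : height z.1 = 0
  · rw [← range_puncturedRay_eq_preimage_label hz]
    exact isPathConnected_range_puncturedRay
  · obtain ⟨f, hf, hr⟩ := exists_isEmbedding_range_eq_preimage_label hz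
    rw [← hr]
    exact isPathConnected_range hf.continuous

end LongPlane

/-! ### Assembly -/

open LongPlane in
theorem mainTheorem4 :
    ∃ (M : Type) (_ : TopologicalSpace M),
      IsSurface M ∧ TopologicalSpace.SeparableSpace M ∧
      (∃ O L : Set M, IsOpen O ∧ O ∪ L = univ ∧ Disjoint O L ∧
        Nonempty (O ≃ₜ {p : ℝ × ℝ // p ≠ (0, 0)}) ∧ Nonempty (L ≃ₜ ClosedLongRay)) ∧
      ∃ F : Foliation M, ∃ Λ : Set M,
        F.IsLeaf Λ ∧ F.LeafHomeomorphic Λ OpenLongRay ∧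
        (∀ l : Set M, F.IsLeaf l → l ≠ Λ → F.LeafHomeomorphic l ℝ) ∧
        (∀ x ∈ Λ, ∀ U ∈ 𝓝 x, ∃ l : Set M,
          F.IsLeaf l ∧ l ≠ Λ ∧ F.LeafHomeomorphic l ℝ ∧ (l ∩ U).Nonempty) := by
  -- With `succ ⊥` only the first interval of the ray enters the planar part, leaving a closed long
  -- ray as its complement.
  obtain ⟨w, hw⟩ := exists_isWeight (Order.bot_lt_succ (⊥ : Omega1)).ne'
  obtain ⟨F, hF⟩ := (isFoliatedAtlas_levelAtlas exists_chart_punctured).exists_foliation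
  have ht := leafTopology_eq_levelTopology exists_chart_punctured F hF
  have hpc : ∀ z, @pathComponent punctured F.leafTopology z = label ⁻¹' {label z} := fun z => by
    rw [ht]
    exact pathComponent_levelTopology (fun z z' h => congrArg Prod.fst h) label_locally_constant
      isPathConnected_preimage_label z
  have hleaf : ∀ z, F.IsLeaf (label ⁻¹' {label z}) := fun z => ⟨z, (hpc z).symm⟩
  have hline : ∀ z : punctured, height z.1 ≠ 0 → F.LeafHomeomorphic (label ⁻¹' {label z}) ℝ := by
    intro z hz
    obtain ⟨f, hf, hr⟩ := exists_isEmbedding_range_eq_preimage_label hz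
    have hfh : ∀ t, height (f t).1 = height z.1 := fun t => by
      have : f t ∈ label ⁻¹' {label z} := hr ▸ mem_range_self t
      exact (label_eq_iff.1 this).1
    rw [← hr]
    exact Foliation.leafHomeomorphic_range ht hf hfh
  refine ⟨punctured, inferInstance, ⟨inferInstance, connectedSpace_punctured hw,
    fun z => (exists_chart_punctured z).imp fun φ h => h.2⟩, separableSpace_punctured hw,
    ⟨Subtype.val ⁻¹' domain w, (Subtype.val ⁻¹' domain w)ᶜ,
      hw.isOpen_domain.preimage continuous_subtype_val, union_compl_self _, disjoint_compl_right,
      exists_homeomorph_planePart hw, exists_homeomorph_compl_planePart hw⟩,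
    F, range puncturedRay, ?_, ?_, ?_, ?_⟩
  · rw [range_puncturedRay (openMk ⊥ (1 / 2) (by norm_num) (by norm_num))]
    exact hleaf _
  · exact Foliation.leafHomeomorphic_range ht isEmbedding_puncturedRay (c := 0) fun p => rfl
  · rintro l ⟨z, rfl⟩ hne
    rw [hpc] at hne ⊢
    exact hline z fun hz => hne (range_puncturedRay_eq_preimage_label hz).symm
  · intro x _ U hU
    obtain ⟨z, hzU, hz⟩ := punctured_exists_mem_height_ne_zero hU
    refine ⟨label ⁻¹' {label z}, hleaf z, fun h => ?_, hline z hz, z, rfl, hzU⟩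
    have : z ∈ range puncturedRay := h ▸ rfl
    obtain ⟨p, rfl⟩ := this
    exact hz rfl
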